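/- Let $1<\gamma<\frac{\sqrt7+1}{\sqrt7-1}$, let $R>0$, and fix a state $(\rho_-,u_-,e_-)$ with $\rho_->0$, $e_->0$. Write $P=(\gamma-1)\rho e$ for the pressure and $c=\sqrt{\gamma(\gamma-1)e}$ for the sound speed. A state $(\rho_+,u_+,e_+)$ with $\rho_+,e_+>0$ and a speed $\sigma$ form, together with $(\rho_-,u_-,e_-)$, a $1$-shock of the Euler equations if, with $v_\pm=u_\pm-\sigma$, the quantities $\rho v$, $\rho v^2+P$ and $\rho v(e+v^2/2)+Pv$ take the same values $j$, $jC_1$, $jC_2$ at both states, and $u_+-c_+<\sigma<u_+$, $\sigma<u_--c_-$. Its strength is $a=|u_+-u_-|/2$, and to it one associates the polynomial function $$f(x)=\frac{4(\gamma-1)}{jR^4(\gamma+1)}\Big(\frac{C_1}{\gamma+1}-x\Big)^3\Big(x+\frac{\gamma C_1}{\gamma+1}\Big)^3\Big(2x+\frac{(\gamma-1)C_1}{\gamma+1}\Big).$$ Then there is a nonincreasing sequence of positive numbers $(a_n)_{n\in\mathbb N}$, depending only on $(\rho_-,u_-,e_-)$, $\gamma$ and $R$, such that for every $n\ge 0$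 and every such $1$-shock with strength $a\in(0,a_n]$ the following holds. (i) $f(0)^2-2a^2>0$ and $w_0:=\frac12\big(-f(0)+\sqrt{f(0)^2-2a^2}\big)<0$. The system $$V'=VW,\qquad W'=-W^2-f(V)W+\frac{V^2-a^2}{2}$$ has a solution $(V_\flat,W_\flat)$ on $\mathbb R$ that tends to $(a,0)$ at $-\infty$ and to $(0,w_0)$ at $+\infty$, with $V_\flat$ strictly decreasing and converging to $0$ exponentially at $+\infty$, and a solution $(V_\sharp,W_\sharp)$ on $\mathbb R$ that tends to $(-a,0)$ at $-\infty$ and to $(0,w_0)$ at $+\infty$, with $V_\sharp$ strictly increasing and converging to $0$ exponentially at $+\infty$. (ii) For all such solutions, $\Xi_\flat(\eta)=-\int_\eta^{+\infty}V_\flat(\zeta)\,d\zeta$ and $\Xi_\sharp(\eta)=-\int_\eta^{+\infty}V_\sharp(\zeta)\,d\zeta$ are bijections from $\mathbb R$ onto $(-\infty,0)$ and $(0,+\infty)$ respectively. The glued functions, defined by $(\hat v,w)=(V_\flat,W_\flat)\circ\Xi_\flat^{-1}$ on $(-\infty,0)$, $(\hat v,w)=(V_\sharp,W_\sharp)\circ\Xi_\sharp^{-1}$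 on $(0,+\infty)$ and $(\hat v,w)(0)=(0,w_0)$, satisfy on all of $\mathbb R$ $$\hat v'=w,\qquad \hat v\,w'=-w^2-f(\hat v)\,w+\frac{\hat v^2-a^2}{2},$$ with $\hat v\in(-a,a)$, $(\hat v,w)\to(a,0)$ at $-\infty$ and $(\hat v,w)\to(-a,0)$ at $+\infty$. Moreover $w\in C^{n+1}(\mathbb R)$, $\hat v\in C^{n+2}(\mathbb R)$, and $$w(\xi)=w_0+w_1\hat v(\xi)+\cdots+w_{n+1}\hat v(\xi)^{n+1}+o\big(\hat v(\xi)^{n+1}\big)\qquad(\xi\to0).$$ Here $$w_k=\frac{b_{k-1}}{f(0)+(k+2)w_0}\quad(1\le k\le n+1),$$ the denominators being nonzero, and $$b_0=-f'(0)w_0,\qquad b_1=\tfrac12-2w_1^2-f'(0)w_1-\tfrac{f''(0)}2w_0\quad(\text{if } n\ge1),$$ $$b_k=-\sum_{i=1}^{k+1}\frac{f^{(i)}(0)}{i!}\,w_{k+1-i}-\sum_{i=1}^{k}(i+1)\,w_i\,w_{k+1-i}\quad(2\le k\le n).$$ -/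

import Mathlib

namespace RadShock

open Set Filter Topology

noncomputable section

/-- Density, velocity and specific internal energy of the gas. -/
structure GasState where
  ρ : ℝ
  u : ℝ
  e : ℝ

/-- Physical states: positive density and positive internal energy. -/
def GasState.Admissible (s : GasState) : Prop := 0 < s.ρ ∧ 0 < s.e

/-- Pressure of a perfect gas. -/
def GasState.pressure (γ : ℝ) (s : GasState) : ℝ := (γ - 1) * s.ρ * s.e

/-- Sound speed of a perfect gas. -/
def GasState.sound (γ : ℝ) (s : GasState) : ℝ := Real.sqrt (γ * (γ - 1) * s.e)

/-- Mass flux `j` of the state `s` in the frame moving at speed `σ`. -/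
def massFlux (σ : ℝ) (s : GasState) : ℝ := s.ρ * (s.u - σ)

/-- Momentum flux in the frame moving at speed `σ`. -/
def momentumFlux (γ σ : ℝ) (s : GasState) : ℝ := s.ρ * (s.u - σ) ^ 2 + s.pressure γ

/-- Energy flux in the frame moving at speed `σ`. -/
def energyFlux (γ σ : ℝ) (s : GasState) : ℝ :=
  s.ρ * (s.u - σ) * (s.e + (s.u - σ) ^ 2 / 2) + s.pressure γ * (s.u - σ)

/-- `(sm, sp)` is a Lax `1`-shock of speed `σ` for the Euler equations: the Rankine-Hugoniot
conditions and the Lax inequalities for the first characteristic family. -/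
structure IsOneShock (γ : ℝ) (sm sp : GasState) (σ : ℝ) : Prop where
  mass : massFlux σ sp = massFlux σ sm
  momentum : momentumFlux γ σ sp = momentumFlux γ σ sm
  energy : energyFlux γ σ sp = energyFlux γ σ sm
  lax_right_lower : sp.u - sp.sound γ < σ
  lax_right_upper : σ < sp.u
  lax_left : σ < sm.u - sm.sound γ

/-- The constant `C₁`: momentum flux divided by mass flux. -/
def C₁ (γ σ : ℝ) (s : GasState) : ℝ := momentumFlux γ σ s / massFlux σ s

/-- Strength of the shock. -/
def strength (sm sp : GasState) : ℝ := |sp.u - sm.u| / 2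

/-- The polynomial function `f` of the travelling wave system, in terms of the constants
`γ`, `R` (perfect gas constant), `j` and `C₁`. -/
def fPoly (γ R j c : ℝ) (x : ℝ) : ℝ :=
  4 * (γ - 1) / (j * R ^ 4 * (γ + 1)) * (c / (γ + 1) - x) ^ 3 *
    (x + γ * c / (γ + 1)) ^ 3 * (2 * x + (γ - 1) * c / (γ + 1))

/-- The function `f` attached to a shock of speed `σ` with left state `sm`. -/
def shockF (γ R σ : ℝ) (sm : GasState) : ℝ → ℝ :=
  fPoly γ R (massFlux σ sm) (C₁ γ σ sm)

/-- The number `w₀`. -/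
def wZero (f : ℝ → ℝ) (a : ℝ) : ℝ := (-f 0 + Real.sqrt (f 0 ^ 2 - 2 * a ^ 2)) / 2

/-- `(V, W)` is a solution, on the whole line, of the desingularized system. -/
def SolvesReg (f : ℝ → ℝ) (a : ℝ) (V W : ℝ → ℝ) : Prop :=
  ∀ η : ℝ, HasDerivAt V (V η * W η) η ∧
    HasDerivAt W (-W η ^ 2 - f (V η) * W η + (V η ^ 2 - a ^ 2) / 2) η

/-- Exponential convergence to `0` at `+∞`. -/
def ExpDecay (V : ℝ → ℝ) : Prop :=
  ∃ C c : ℝ, 0 < c ∧ ∀ η : ℝ, 0 ≤ η → |V η| ≤ C * Real.exp (-c * η)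

/-- The orbit from `(a, 0)` to `(0, w₀)`, with decreasing first component. -/
structure IsFlat (f : ℝ → ℝ) (a : ℝ) (V W : ℝ → ℝ) : Prop where
  solves : SolvesReg f a V W
  V_atBot : Tendsto V atBot (𝓝 a)
  W_atBot : Tendsto W atBot (𝓝 0)
  V_atTop : Tendsto V atTop (𝓝 0)
  W_atTop : Tendsto W atTop (𝓝 (wZero f a))
  anti : StrictAnti V
  decay : ExpDecay V

/-- The orbit from `(-a, 0)` to `(0, w₀)`, with increasing first component. -/
structure IsSharp (f : ℝ → ℝ) (a : ℝ) (V W : ℝ → ℝ) : Prop where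
  solves : SolvesReg f a V W
  V_atBot : Tendsto V atBot (𝓝 (-a))
  W_atBot : Tendsto W atBot (𝓝 0)
  V_atTop : Tendsto V atTop (𝓝 0)
  W_atTop : Tendsto W atTop (𝓝 (wZero f a))
  mono : StrictMono V
  decay : ExpDecay V

/-- The change of variable `Ξ(η) = -∫_η^{+∞} V(ζ) dζ`. -/
def Xi (V : ℝ → ℝ) (η : ℝ) : ℝ := -∫ ζ in Ioi η, V ζ

/-- `G₁ ∘ Ξ₁⁻¹` for `ξ < 0`, `G₂ ∘ Ξ₂⁻¹` for `ξ > 0`, and the value `z` at `ξ = 0`, where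
`Ξ₁, Ξ₂` are the changes of variable attached to `V₁, V₂`. -/
def glue (V₁ V₂ G₁ G₂ : ℝ → ℝ) (z : ℝ) (ξ : ℝ) : ℝ :=
  if ξ < 0 then G₁ (Function.invFun (Xi V₁) ξ)
  else if 0 < ξ then G₂ (Function.invFun (Xi V₂) ξ)
  else z

/-- `(v, w)` solves, on the whole line, the (singular) travelling wave system, connects `(a, 0)`
to `(-a, 0)`, and `v` takes its values in `(-a, a)`. -/
structure IsProfile (f : ℝ → ℝ) (a : ℝ) (v w : ℝ → ℝ) : Prop where
  hasDeriv_v : ∀ ξ : ℝ, HasDerivAt v (w ξ) ξ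
  differentiable_w : Differentiable ℝ w
  eq_w : ∀ ξ : ℝ, v ξ * deriv w ξ = -w ξ ^ 2 - f (v ξ) * w ξ + (v ξ ^ 2 - a ^ 2) / 2
  v_atBot : Tendsto v atBot (𝓝 a)
  w_atBot : Tendsto w atBot (𝓝 0)
  v_atTop : Tendsto v atTop (𝓝 (-a))
  w_atTop : Tendsto w atTop (𝓝 0)
  mem : ∀ ξ : ℝ, v ξ ∈ Ioo (-a) a

/-- The recursive formulas for `w₀, …, w_{n+1}` and `b₀, …, b_n`. They determine these numbers;
the divisions are by nonzero numbers. -/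
structure IsCoeffs (f : ℝ → ℝ) (a : ℝ) (n : ℕ) (w b : ℕ → ℝ) : Prop where
  w_zero : w 0 = wZero f a
  denom_ne : ∀ k ∈ Finset.Icc 1 (n + 1), f 0 + ((k : ℝ) + 2) * w 0 ≠ 0
  w_eq : ∀ k ∈ Finset.Icc 1 (n + 1), w k = b (k - 1) / (f 0 + ((k : ℝ) + 2) * w 0)
  b_zero : b 0 = -deriv f 0 * w 0
  b_one : 1 ≤ n →
    b 1 = 1 / 2 - 2 * w 1 ^ 2 - deriv f 0 * w 1 - iteratedDeriv 2 f 0 / 2 * w 0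
  b_eq : ∀ k ∈ Finset.Icc 2 n,
    b k = -(∑ i ∈ Finset.Icc 1 (k + 1), iteratedDeriv i f 0 / (i.factorial : ℝ) * w (k + 1 - i))
      - (∑ i ∈ Finset.Icc 1 k, ((i : ℝ) + 1) * w i * w (k + 1 - i))

end

end RadShock

open Set Filter Topology RadShock

/-!
On the orbit leaving `(a, 0)` write `W = -(a - V) k` and choose the time in which `V` is the
logistic function. The slope `k` then solves a scalar nonautonomous equation which is dissipative as
soon as `2 a ≤ f` on `[0, a]`; its bounded solution is the fixed point of a contraction, and damping
forces `k → -w₀ / a` at `+∞`. Undoing the change of time gives `(V_♭, W_♭)`, and the symmetry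
`V ↦ -V` gives `(V_♯, W_♯)`.

At the sonic point, the glued profile and its successive derivatives solve linear equations
`φ y' = α y + β` with `φ = v̂` vanishing at `0`. Each differentiation lowers `α (0) / φ' (0)` by
`1`, and as long as this ratio is positive, `y` has the limit `-β (0) / α (0)`. The ratios met in
the proof of `C^{n+1}` regularity are `-(f (0) + (k + 3) w₀) / w₀` with `k ≤ n`, and they are
positive when `(n + 3) a ≤ f (0)`. The remainder of the expansion of `w` obeys an equation
of the same kind.

Finally, the mass flux stays bounded along weak shocks while `C₁` is at least the sound speed of the
left state, so `f` is bounded below near `0` uniformly in the shock, and small `a` meets the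
conditions above.
-/

namespace RadShock

section DampedEquation

variable {y z α β ε φ : ℝ → ℝ}

lemma antitoneOn_of_damped {m s T : ℝ} (hm : 0 < m)
    (hz : ∀ t ≥ T, HasDerivAt z (-α t * z t + ε t) t) (hα : ∀ t ≥ T, m ≤ α t)
    (hε : ∀ t ≥ T, |ε t| ≤ m * s) :
    AntitoneOn (fun t => (z t ^ 2 - s ^ 2) * Real.exp (m * t)) (Ici T) := by
  have hderiv : ∀ t ≥ T, HasDerivAt (fun t => (z t ^ 2 - s ^ 2) * Real.exp (m * t))
      ((2 * z t * (-α t * z t + ε t) + m * (z t ^ 2 - s ^ 2)) * Real.exp (m * t)) t := by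
    intro t ht
    have hexp : HasDerivAt (fun t => Real.exp (m * t)) (Real.exp (m * t) * m) t := by
      simpa using ((hasDerivAt_id t).const_mul m).exp
    exact ((((hz t ht).pow 2).sub_const (s ^ 2)).mul hexp).congr_deriv (by norm_num; ring)
  refine antitoneOn_of_hasDerivWithinAt_nonpos (convex_Ici T)
    (fun t ht => (hderiv t ht).continuousAt.continuousWithinAt)
    (fun t ht => (hderiv t (interior_subset ht)).hasDerivWithinAt) fun t ht => ?_
  replace ht : T ≤ t := interior_subset ht
  refine mul_nonpos_of_nonpos_of_nonneg ?_ (Real.exp_pos _).le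
  have hdamp : m * z t ^ 2 ≤ α t * z t ^ 2 := by gcongr; exact hα t ht
  have hforce : z t * ε t ≤ |z t| * (m * s) :=
    (le_abs_self _).trans (by rw [abs_mul]; gcongr; exact hε t ht)
  have hamgm : 2 * (m * (|z t| * s)) ≤ m * (z t ^ 2 + s ^ 2) := by
    rw [← sq_abs (z t)]
    nlinarith [mul_nonneg hm.le (sq_nonneg (|z t| - s))]
  linarith

lemma tendsto_zero_of_damped {m : ℝ} (hm : 0 < m)
    (hz : ∀ᶠ t in atTop, HasDerivAt z (-α t * z t + ε t) t)
    (hα : ∀ᶠ t in atTop, m ≤ α t) (hε : Tendsto ε atTop (𝓝 0)) :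
    Tendsto z atTop (𝓝 0) := by
  rw [tendsto_zero_iff_abs_tendsto_zero, tendsto_order]
  refine ⟨fun r hr => .of_forall fun t => hr.trans_le (abs_nonneg _), fun s hs => ?_⟩
  have hε_small : ∀ᶠ t in atTop, |ε t| < m * (s / 2) := by
    simpa using hε.abs.eventually_lt_const (by simpa using mul_pos hm (half_pos hs))
  obtain ⟨T, hT⟩ := eventually_atTop.1 (hz.and (hα.and hε_small))
  have hanti := antitoneOn_of_damped hm (fun t ht => (hT t ht).1) (fun t ht => (hT t ht).2.1)
    (fun t ht => (hT t ht).2.2.le)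
  set q := fun t => (z t ^ 2 - (s / 2) ^ 2) * Real.exp (m * t)
  have hlim : Tendsto (fun t => (s / 2) ^ 2 + q T * Real.exp (-(m * t))) atTop
      (𝓝 ((s / 2) ^ 2 + q T * 0)) :=
    tendsto_const_nhds.add (tendsto_const_nhds.mul
      (Real.tendsto_exp_neg_atTop_nhds_zero.comp (tendsto_id.const_mul_atTop hm)))
  have hlt : (s / 2) ^ 2 + q T * 0 < s ^ 2 := by nlinarith
  filter_upwards [hlim.eventually_lt_const hlt, eventually_ge_atTop T] with t hts htT
  have hzt : z t ^ 2 - (s / 2) ^ 2 ≤ q T * Real.exp (-(m * t)) := by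
    rw [Real.exp_neg, ← div_eq_mul_inv, le_div_iff₀ (Real.exp_pos _)]
    exact hanti self_mem_Ici htT htT
  simpa using abs_lt_of_sq_lt_sq (by linarith) hs.le

-- In the variable `t = -log x` the equation `φ y' = α y + β` becomes uniformly damped.
lemma tendsto_nhdsGT_of_singular {ω α₀ β₀ : ℝ}
    (hφ : HasDerivAt φ ω 0) (hφ0 : φ 0 = 0) (hω : ω ≠ 0)
    (hy : ∀ᶠ x in 𝓝[>] 0, HasDerivAt y ((α x * y x + β x) / φ x) x)
    (hα : Tendsto α (𝓝[>] 0) (𝓝 α₀)) (hβ : Tendsto β (𝓝[>] 0) (𝓝 β₀)) (hpos : 0 < α₀ / ω) :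
    Tendsto y (𝓝[>] 0) (𝓝 (-β₀ / α₀)) := by
  have hα₀ : α₀ ≠ 0 := by rintro rfl; simp at hpos
  set L := -β₀ / α₀ with hL
  have hratio : Tendsto (fun x => x / φ x) (𝓝[>] 0) (𝓝 ω⁻¹) := by
    have hslope := (hasDerivAt_iff_tendsto_slope.1 hφ).mono_left (nhdsGT_le_nhdsNE _)
    exact (hslope.inv₀ hω).congr fun x => by simp [slope_def_field, hφ0]
  have hexp : Tendsto (fun t : ℝ => Real.exp (-t)) atTop (𝓝[>] 0) :=
    Real.tendsto_exp_atBot_nhdsGT.comp tendsto_neg_atTop_atBot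
  have hdamping : Tendsto (fun t : ℝ => Real.exp (-t) / φ (Real.exp (-t)) * α (Real.exp (-t)))
      atTop (𝓝 (α₀ / ω)) := by
    rw [div_eq_inv_mul]
    exact (hratio.mul hα).comp hexp
  have hforcing : Tendsto (fun t : ℝ => -(Real.exp (-t) / φ (Real.exp (-t)) *
      (α (Real.exp (-t)) * L + β (Real.exp (-t))))) atTop (𝓝 0) := by
    have hlim := (hratio.mul ((hα.mul_const L).add hβ)).neg.comp hexp
    have hroot : α₀ * L + β₀ = 0 := by rw [hL]; field_simp; ring
    rwa [hroot, mul_zero, neg_zero] at hlim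
  have hz : Tendsto (fun t => y (Real.exp (-t)) - L) atTop (𝓝 0) := by
    refine tendsto_zero_of_damped (half_pos hpos) ?_
      ((hdamping.eventually_const_lt (half_lt_self hpos)).mono fun t ht => ht.le) hforcing
    filter_upwards [hexp.eventually hy] with t ht
    exact ((ht.comp t (hasDerivAt_neg t).exp).sub_const L).congr_deriv (by ring)
  have hlog : Tendsto (fun x : ℝ => -Real.log x) (𝓝[>] 0) atTop :=
    tendsto_neg_atBot_atTop.comp Real.tendsto_log_nhdsGT_zero
  have hyL := (hz.comp hlog).add_const L
  rw [zero_add] at hyL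
  refine hyL.congr' ?_
  filter_upwards [self_mem_nhdsWithin] with x hx
  simp [Real.exp_log hx]

lemma tendsto_of_singular {ω α₀ β₀ : ℝ}
    (hφ : HasDerivAt φ ω 0) (hφ0 : φ 0 = 0) (hω : ω ≠ 0)
    (hy : ∀ᶠ x in 𝓝[≠] 0, HasDerivAt y ((α x * y x + β x) / φ x) x)
    (hα : Tendsto α (𝓝[≠] 0) (𝓝 α₀)) (hβ : Tendsto β (𝓝[≠] 0) (𝓝 β₀)) (hpos : 0 < α₀ / ω) :
    Tendsto y (𝓝[≠] 0) (𝓝 (-β₀ / α₀)) := by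
  have hneg : Tendsto (fun x : ℝ => -x) (𝓝[>] 0) (𝓝[<] 0) := by
    simpa using tendsto_neg_nhdsGT (a := (0 : ℝ))
  have hneg' : Tendsto (fun x : ℝ => -x) (𝓝[<] 0) (𝓝[>] 0) := by
    simpa using tendsto_neg_nhdsLT (a := (0 : ℝ))
  rw [← Iio_union_Ioi, nhdsWithin_union, tendsto_sup]
  refine ⟨?_, tendsto_nhdsGT_of_singular hφ hφ0 hω (hy.filter_mono (nhdsGT_le_nhdsNE _))
    (hα.mono_left (nhdsGT_le_nhdsNE _)) (hβ.mono_left (nhdsGT_le_nhdsNE _)) hpos⟩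
  have hreflect : Tendsto (fun x => y (-x)) (𝓝[>] 0) (𝓝 (-β₀ / α₀)) := by
    refine tendsto_nhdsGT_of_singular (φ := fun x => -φ (-x)) ?_ (by simp [hφ0]) hω ?_
      ((hα.mono_left (nhdsLT_le_nhdsNE _)).comp hneg)
      ((hβ.mono_left (nhdsLT_le_nhdsNE _)).comp hneg) hpos
    · have hφ' : HasDerivAt φ ω (-0) := by simpa using hφ
      exact (hφ'.comp 0 (hasDerivAt_neg 0)).neg.congr_deriv (by ring)
    · filter_upwards [hneg.eventually (hy.filter_mono (nhdsLT_le_nhdsNE _))] with x hx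
      refine (hx.comp x (hasDerivAt_neg x)).congr_deriv ?_
      simp only [Function.comp_apply, div_neg, mul_neg_one]
  exact (hreflect.comp hneg').congr fun x => by simp

end DampedEquation

section Regularity

lemma contDiff_succ_of_hasDerivAt {y d : ℝ → ℝ} {k : ℕ} (hd : ContDiff ℝ k d)
    (hy : ∀ x, HasDerivAt y (d x) x) : ContDiff ℝ ((k + 1 : ℕ) : WithTop ℕ∞) y := by
  rw [Nat.cast_add, Nat.cast_one, contDiff_succ_iff_deriv]
  refine ⟨fun x => (hy x).differentiableAt, by simp, ?_⟩
  rwa [show deriv y = d from funext fun x => (hy x).deriv]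

lemma contDiff_deriv_of_succ {y : ℝ → ℝ} {k : ℕ} (hy : ContDiff ℝ ((k + 1 : ℕ) : WithTop ℕ∞) y) :
    ContDiff ℝ k (deriv y) := by
  rw [Nat.cast_add, Nat.cast_one, contDiff_succ_iff_deriv] at hy
  exact hy.2.2

lemma contDiff_succ_of_hasDerivAt_of_ne {y g : ℝ → ℝ} {x₀ c : ℝ} {k : ℕ} (hy₀ : ContinuousAt y x₀)
    (hy : ∀ x ≠ x₀, HasDerivAt y (g x) x) (hg : ContDiff ℝ k (Function.update g x₀ c)) :
    ContDiff ℝ ((k + 1 : ℕ) : WithTop ℕ∞) y :=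
  contDiff_succ_of_hasDerivAt hg <| hasDerivAt_of_hasDerivAt_of_ne'
    (fun x hx => by simpa [Function.update_of_ne hx] using hy x hx) hy₀ hg.continuous.continuousAt

lemma hasDerivAt_singularQuotient {y α β φ : ℝ → ℝ} {α' β' φ' x : ℝ} (hφx : φ x ≠ 0)
    (hy : HasDerivAt y ((α x * y x + β x) / φ x) x) (hα : HasDerivAt α α' x)
    (hβ : HasDerivAt β β' x) (hφ : HasDerivAt φ φ' x) :
    HasDerivAt (fun x => (α x * y x + β x) / φ x)
      (((α x - φ') * ((α x * y x + β x) / φ x) + (α' * y x + β')) / φ x) x := by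
  refine (((hα.mul hy).add hβ).div hφ hφx).congr_deriv ?_
  simp only [Pi.add_apply, Pi.mul_apply]
  field_simp
  ring

lemma hasDerivAt_update_of_ne {g : ℝ → ℝ} {x₀ x c g' : ℝ} (hx : x ≠ x₀) (hg : HasDerivAt g g' x) :
    HasDerivAt (Function.update g x₀ c) g' x :=
  hg.congr_of_eventuallyEq <|
    eventually_of_mem (isOpen_ne.mem_nhds hx) fun _ hz => Function.update_of_ne hz _ _

-- The derivative of `y` solves an equation of the same form, with `α` replaced by `α - φ'`.
lemma contDiff_of_singular {φ : ℝ → ℝ} (hφ0 : φ 0 = 0) (hφne : ∀ x ≠ 0, φ x ≠ 0)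
    (hω : deriv φ 0 ≠ 0) (k : ℕ) {y α β : ℝ → ℝ}
    (hφ : ContDiff ℝ ((k + 1 : ℕ) : WithTop ℕ∞) φ) (hα : ContDiff ℝ k α) (hβ : ContDiff ℝ k β)
    (hk : k < α 0 / deriv φ 0) (hy : ∀ x ≠ 0, HasDerivAt y ((α x * y x + β x) / φ x) x)
    (hy0 : y 0 = -β 0 / α 0) :
    ContDiff ℝ k y := by
  have dφ : ∀ x, HasDerivAt φ (deriv φ x) x := fun x =>
    (hφ.differentiable (by simp) x).hasDerivAt
  induction k generalizing y α β with
  | zero =>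
    rw [Nat.cast_zero, contDiff_zero] at hα hβ ⊢
    rw [continuous_iff_continuousAt]
    intro x
    obtain rfl | hx := eq_or_ne x 0
    · rw [← continuousWithinAt_compl_self, ContinuousWithinAt, hy0]
      exact tendsto_of_singular (dφ 0) hφ0 hω (eventually_mem_nhdsWithin.mono hy)
        hα.continuousAt.continuousWithinAt hβ.continuousAt.continuousWithinAt (by simpa using hk)
    · exact (hy x hx).continuousAt
  | succ k ih =>
    have hle : (k : WithTop ℕ∞) ≤ ((k + 1 : ℕ) : WithTop ℕ∞) := by gcongr; omega
    have hφk : ContDiff ℝ ((k + 1 : ℕ) : WithTop ℕ∞) φ := hφ.of_le (by gcongr; omega)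
    have hk' : k < (α 0 - deriv φ 0) / deriv φ 0 := by
      rw [sub_div, div_self hω]; push_cast at hk; linarith
    have hyk : ContDiff ℝ k y :=
      ih hφk (hα.of_le hle) (hβ.of_le hle) (by push_cast at hk; linarith) hy hy0
    refine contDiff_succ_of_hasDerivAt_of_ne hyk.continuous.continuousAt hy <|
      ih hφk (α := fun x => α x - deriv φ x) (β := fun x => deriv α x * y x + deriv β x)
        ((hα.of_le hle).sub ((contDiff_deriv_of_succ hφ).of_le hle))
        (((contDiff_deriv_of_succ hα).mul hyk).add (contDiff_deriv_of_succ hβ)) hk' ?_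
        (Function.update_self ..)
    intro x hx
    rw [Function.update_of_ne hx]
    exact hasDerivAt_update_of_ne hx <| hasDerivAt_singularQuotient (hφne x hx) (hy x hx)
      (hα.differentiable (by simp) x).hasDerivAt (hβ.differentiable (by simp) x).hasDerivAt (dφ x)

end Regularity

section SonicCrossing

/-- Second component of the desingularized vector field, so that the singular travelling wave
system reads `v' = w`, `v w' = transverseField f a v w`. -/
noncomputable def transverseField (f : ℝ → ℝ) (a v w : ℝ) : ℝ :=
  -w ^ 2 - f v * w + (v ^ 2 - a ^ 2) / 2

/-- `(v, w)` solves the singular travelling wave system away from `x = 0`, where it passes through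
the sonic point `(0, w₀)`. -/
structure IsSonicCrossing (f : ℝ → ℝ) (a : ℝ) (v w : ℝ → ℝ) : Prop where
  v_zero : v 0 = 0
  v_ne_zero : ∀ x ≠ 0, v x ≠ 0
  w_zero : w 0 = wZero f a
  continuousAt_w : ContinuousAt w 0
  hasDerivAt_v : ∀ x, HasDerivAt v (w x) x
  hasDerivAt_w : ∀ x ≠ 0, HasDerivAt w (transverseField f a (v x) (w x) / v x) x

namespace IsSonicCrossing

variable {f v w : ℝ → ℝ} {a : ℝ} {n : ℕ}

lemma deriv_v (h : IsSonicCrossing f a v w) : deriv v = w :=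
  funext fun x => (h.hasDerivAt_v x).deriv

lemma continuous_v (h : IsSonicCrossing f a v w) : Continuous v :=
  continuous_iff_continuousAt.2 fun x => (h.hasDerivAt_v x).continuousAt

lemma continuous_w (h : IsSonicCrossing f a v w) : Continuous w := by
  refine continuous_iff_continuousAt.2 fun x => ?_
  obtain rfl | hx := eq_or_ne x 0
  exacts [h.continuousAt_w, (h.hasDerivAt_w x hx).continuousAt]

lemma hasDerivAt_transverseField_div (h : IsSonicCrossing f a v w) {x : ℝ} (hx : x ≠ 0)
    (hf : DifferentiableAt ℝ f (v x)) :
    HasDerivAt (fun x => transverseField f a (v x) (w x) / v x)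
      (((-3 * w x - f (v x)) * (transverseField f a (v x) (w x) / v x) +
        (v x * w x - deriv f (v x) * w x ^ 2)) / v x) x := by
  have hfv : HasDerivAt (fun x => f (v x)) (deriv f (v x) * w x) x :=
    hf.hasDerivAt.comp x (h.hasDerivAt_v x)
  have hα : HasDerivAt (fun x => -w x - f (v x))
      (-(transverseField f a (v x) (w x) / v x) - deriv f (v x) * w x) x :=
    (h.hasDerivAt_w x hx).neg.sub hfv
  have hβ : HasDerivAt (fun x => (v x ^ 2 - a ^ 2) / 2) (v x * w x) x :=
    ((((h.hasDerivAt_v x).pow 2).sub_const (a ^ 2)).div_const 2).congr_deriv (by norm_num; ring)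
  have hsplit : ∀ x, transverseField f a (v x) (w x) =
      (-w x - f (v x)) * w x + (v x ^ 2 - a ^ 2) / 2 := fun x => by
    unfold transverseField; ring
  have hw := h.hasDerivAt_w x hx
  simp only [hsplit] at hw hα ⊢
  refine (hasDerivAt_singularQuotient (h.v_ne_zero x hx) hw hα hβ
    (h.hasDerivAt_v x)).congr_deriv ?_
  ring

lemma contDiff_w (h : IsSonicCrossing f a v w) (hf : ContDiff ℝ ((n + 1 : ℕ) : WithTop ℕ∞) f)
    (hw₀ : wZero f a < 0) (hn : 0 < f 0 + (n + 3) * wZero f a) :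
    ContDiff ℝ ((n + 1 : ℕ) : WithTop ℕ∞) w := by
  suffices ∀ k ≤ n + 1, ContDiff ℝ k w from this _ le_rfl
  intro k
  induction k with
  | zero => exact fun _ => contDiff_zero.2 h.continuous_w
  | succ k ih =>
    intro hk
    have hwk : ContDiff ℝ k w := ih (by omega)
    have hvk : ContDiff ℝ ((k + 1 : ℕ) : WithTop ℕ∞) v :=
      contDiff_succ_of_hasDerivAt hwk h.hasDerivAt_v
    have hvk' : ContDiff ℝ k v := hvk.of_le (by gcongr; omega)
    have hfk : ContDiff ℝ k f := hf.of_le (by gcongr; omega)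
    have hfk' : ContDiff ℝ k (deriv f) := (contDiff_deriv_of_succ hf).of_le (by gcongr; omega)
    refine contDiff_succ_of_hasDerivAt_of_ne h.continuousAt_w h.hasDerivAt_w <|
      contDiff_of_singular h.v_zero h.v_ne_zero (by rw [h.deriv_v, h.w_zero]; exact hw₀.ne) k
        (α := fun x => -3 * w x - f (v x)) (β := fun x => v x * w x - deriv f (v x) * w x ^ 2)
        hvk ((contDiff_const.mul hwk).sub (hfk.comp hvk'))
        ((hvk'.mul hwk).sub ((hfk'.comp hvk').mul (hwk.pow 2))) ?_ ?_ (Function.update_self ..)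
    · rw [h.deriv_v, h.w_zero, h.v_zero, lt_div_iff_of_neg hw₀]
      have : (k : ℝ) ≤ n := by exact_mod_cast (by omega : k ≤ n)
      nlinarith
    · intro x hx
      rw [Function.update_of_ne hx]
      exact hasDerivAt_update_of_ne hx <|
        h.hasDerivAt_transverseField_div hx (hf.differentiable (by simp) _)

lemma contDiff_v (h : IsSonicCrossing f a v w) (hf : ContDiff ℝ ((n + 1 : ℕ) : WithTop ℕ∞) f)
    (hw₀ : wZero f a < 0) (hn : 0 < f 0 + (n + 3) * wZero f a) :
    ContDiff ℝ ((n + 2 : ℕ) : WithTop ℕ∞) v :=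
  contDiff_succ_of_hasDerivAt (h.contDiff_w hf hw₀ hn) h.hasDerivAt_v

end IsSonicCrossing

end SonicCrossing

section ExponentialAverage

open MeasureTheory
open scoped BoundedContinuousFunction

/-- The bounded solution of `y' = h - Λ y`. -/
noncomputable def expAverage (Λ : ℝ) (h : ℝ → ℝ) (s : ℝ) : ℝ :=
  Real.exp (-(Λ * s)) * ∫ r in Iic s, Real.exp (Λ * r) * h r

variable {Λ : ℝ}

lemma integrableOn_exp_mul (hΛ : 0 < Λ) (h : ℝ →ᵇ ℝ) (s : ℝ) :
    IntegrableOn (fun r => Real.exp (Λ * r) * h r) (Iic s) :=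
  (integrableOn_exp_mul_Iic hΛ s).mul_bdd h.continuous.aestronglyMeasurable
    (.of_forall h.norm_coe_le_norm)

lemma hasDerivAt_integral_Iic {g : ℝ → ℝ} (hg : Continuous g) (hint : ∀ s, IntegrableOn g (Iic s))
    (s : ℝ) : HasDerivAt (fun s => ∫ r in Iic s, g r) (g s) s := by
  refine ((hg.integral_hasStrictDerivAt 0 s).hasDerivAt.const_add
    (∫ r in Iic 0, g r)).congr_of_eventuallyEq (.of_forall fun x => ?_)
  simp only [← intervalIntegral.integral_Iic_sub_Iic (hint 0) (hint x), add_sub_cancel]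

lemma hasDerivAt_expAverage (hΛ : 0 < Λ) (h : ℝ →ᵇ ℝ) (s : ℝ) :
    HasDerivAt (expAverage Λ h) (h s - Λ * expAverage Λ h s) s := by
  have hexp : HasDerivAt (fun s => Real.exp (-(Λ * s))) (Real.exp (-(Λ * s)) * (-Λ)) s := by
    simpa using ((hasDerivAt_id s).const_mul Λ).neg.exp
  refine (hexp.mul (hasDerivAt_integral_Iic (by fun_prop) (integrableOn_exp_mul hΛ h) s)
    ).congr_deriv ?_
  have hcancel : Real.exp (-(Λ * s)) * Real.exp (Λ * s) = 1 := by rw [← Real.exp_add]; simp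
  unfold expAverage
  linear_combination h s * hcancel

lemma expAverage_mono (hΛ : 0 < Λ) {h₁ h₂ : ℝ →ᵇ ℝ} (hle : h₁ ≤ h₂) (s : ℝ) :
    expAverage Λ h₁ s ≤ expAverage Λ h₂ s := by
  refine mul_le_mul_of_nonneg_left (setIntegral_mono (integrableOn_exp_mul hΛ h₁ s)
    (integrableOn_exp_mul hΛ h₂ s) fun r => ?_) (Real.exp_pos _).le
  gcongr
  exact hle r

lemma expAverage_const (hΛ : 0 < Λ) (c s : ℝ) :
    expAverage Λ (BoundedContinuousFunction.const ℝ c) s = c / Λ := by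
  simp only [expAverage, BoundedContinuousFunction.const_apply]
  rw [integral_mul_const, integral_exp_mul_Iic hΛ, Real.exp_neg]
  field_simp

lemma expAverage_sub (hΛ : 0 < Λ) (h₁ h₂ : ℝ →ᵇ ℝ) (s : ℝ) :
    expAverage Λ (h₁ - h₂ : ℝ →ᵇ ℝ) s = expAverage Λ h₁ s - expAverage Λ h₂ s := by
  simp only [expAverage, BoundedContinuousFunction.coe_sub, Pi.sub_apply, mul_sub]
  rw [integral_sub (integrableOn_exp_mul hΛ h₁ s) (integrableOn_exp_mul hΛ h₂ s), mul_sub]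

lemma expAverage_mem_Icc (hΛ : 0 < Λ) {h : ℝ →ᵇ ℝ} {lo hi : ℝ}
    (hh : ∀ r, h r ∈ Icc (Λ * lo) (Λ * hi)) (s : ℝ) : expAverage Λ h s ∈ Icc lo hi := by
  have hlo := expAverage_mono hΛ (h₁ := .const ℝ (Λ * lo)) (h₂ := h) (fun r => (hh r).1) s
  have hhi := expAverage_mono hΛ (h₁ := h) (h₂ := .const ℝ (Λ * hi)) (fun r => (hh r).2) s
  rw [expAverage_const hΛ, mul_div_cancel_left₀ _ hΛ.ne'] at hlo hhi
  exact ⟨hlo, hhi⟩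

end ExponentialAverage

section Dissipative

open scoped BoundedContinuousFunction

/-- The time-dependent scalar field `F s` points inwards at the ends of `[lo, hi]`, and its slopes
there lie between `-Λ` and `-μ`. -/
structure IsDissipative (F : ℝ → ℝ → ℝ) (lo hi μ Λ : ℝ) : Prop where
  pos : 0 < μ
  le : μ ≤ Λ
  continuousOn : ContinuousOn (Function.uncurry F) (univ ×ˢ Icc lo hi)
  left_nonneg : ∀ s, 0 ≤ F s lo
  right_nonpos : ∀ s, F s hi ≤ 0
  slope : ∀ s, ∀ k ∈ Icc lo hi, ∀ k' ∈ Icc lo hi, k ≤ k' →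
    F s k' - F s k ∈ Icc (-Λ * (k' - k)) (-μ * (k' - k))

namespace IsDissipative

variable {F : ℝ → ℝ → ℝ} {lo hi μ Λ : ℝ}

lemma add_mul_mem_Icc (hF : IsDissipative F lo hi μ Λ) (s : ℝ) {k : ℝ} (hk : k ∈ Icc lo hi) :
    F s k + Λ * k ∈ Icc (Λ * lo) (Λ * hi) := by
  have hlohi := hk.1.trans hk.2
  have hlo := (hF.slope s lo (left_mem_Icc.2 hlohi) k hk hk.1).1
  have hhi := (hF.slope s k hk hi (right_mem_Icc.2 hlohi) hk.2).1
  constructor <;> linarith [hF.left_nonneg s, hF.right_nonpos s]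

lemma abs_sub_le (hF : IsDissipative F lo hi μ Λ) (s : ℝ) {k k' : ℝ} (hk : k ∈ Icc lo hi)
    (hk' : k' ∈ Icc lo hi) :
    |(F s k + Λ * k) - (F s k' + Λ * k')| ≤ (Λ - μ) * |k - k'| := by
  wlog hle : k' ≤ k generalizing k k'
  · rw [abs_sub_comm, abs_sub_comm k]
    exact this hk' hk (not_le.1 hle).le
  obtain ⟨hlower, hupper⟩ := hF.slope s k' hk' k hk hle
  rw [abs_of_nonneg (sub_nonneg.2 hle), abs_of_nonneg (by linarith)]
  linarith

/-- The forcing `F(s, k) + Λ k` of the equation `k' = F(s, k)` rewritten as `k' + Λ k = …`. -/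
noncomputable def forcing (hF : IsDissipative F lo hi μ Λ) (k : ℝ →ᵇ Icc lo hi) : ℝ →ᵇ ℝ :=
  .ofNormedAddCommGroup (fun s => F s (k s) + Λ * k s)
    ((hF.continuousOn.comp_continuous (f := fun s => (s, (k s : ℝ))) (by fun_prop)
      fun s => ⟨mem_univ s, (k s).2⟩).add (by fun_prop))
    (max |Λ * lo| |Λ * hi|) fun s =>
      abs_le_max_abs_abs (hF.add_mul_mem_Icc s (k s).2).1 (hF.add_mul_mem_Icc s (k s).2).2

lemma continuous_expAverage_forcing (hF : IsDissipative F lo hi μ Λ) (k : ℝ →ᵇ Icc lo hi) :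
    Continuous (expAverage Λ (hF.forcing k)) :=
  continuous_iff_continuousAt.2 fun s =>
    (hasDerivAt_expAverage (hF.pos.trans_le hF.le) (hF.forcing k) s).continuousAt

/-- The Picard operator of `k' = F(s, k)`, which takes `k` to the bounded solution `y` of
`y' + Λ y = F(s, k) + Λ k`. -/
noncomputable def picard (hF : IsDissipative F lo hi μ Λ) (k : ℝ →ᵇ Icc lo hi) : ℝ →ᵇ Icc lo hi :=
  .mkOfBound
    ⟨fun s => ⟨expAverage Λ (hF.forcing k) s,
      expAverage_mem_Icc (hF.pos.trans_le hF.le) (fun r => hF.add_mul_mem_Icc r (k r).2) s⟩,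
      (hF.continuous_expAverage_forcing k).subtype_mk _⟩
    (hi - lo) fun _ _ => Real.dist_le_of_mem_Icc (Subtype.prop _) (Subtype.prop _)

lemma contractingWith_picard (hF : IsDissipative F lo hi μ Λ) :
    ContractingWith (1 - μ / Λ).toNNReal hF.picard := by
  have hΛ : 0 < Λ := hF.pos.trans_le hF.le
  have hq : 0 ≤ 1 - μ / Λ := sub_nonneg.2 ((div_le_one hΛ).2 hF.le)
  refine ⟨Real.toNNReal_lt_one.2 (sub_lt_self _ (div_pos hF.pos hΛ)),
    LipschitzWith.of_dist_le_mul fun k k' => ?_⟩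
  rw [Real.coe_toNNReal _ hq, BoundedContinuousFunction.dist_le (by positivity)]
  intro s
  rw [Subtype.dist_eq, Real.dist_eq]
  change |expAverage Λ (hF.forcing k) s - expAverage Λ (hF.forcing k') s| ≤ _
  rw [← expAverage_sub hΛ, abs_le, ← mem_Icc]
  refine expAverage_mem_Icc hΛ (fun r => ?_) s
  rw [mul_neg, mem_Icc, ← abs_le]
  calc |hF.forcing k r - hF.forcing k' r|
      ≤ (Λ - μ) * |(k r : ℝ) - k' r| := hF.abs_sub_le r (k r).2 (k' r).2
    _ ≤ (Λ - μ) * dist k k' := by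
        gcongr
        exacts [sub_nonneg.2 hF.le, BoundedContinuousFunction.dist_coe_le_dist (f := k) r]
    _ = Λ * ((1 - μ / Λ) * dist k k') := by field_simp

lemma exists_solution (hF : IsDissipative F lo hi μ Λ) (hlohi : lo ≤ hi) :
    ∃ k : ℝ → ℝ, (∀ s, k s ∈ Icc lo hi) ∧ ∀ s, HasDerivAt k (F s (k s)) s := by
  have : Nonempty (ℝ →ᵇ Icc lo hi) := ⟨.const ℝ ⟨lo, left_mem_Icc.2 hlohi⟩⟩
  obtain ⟨k, hk⟩ : ∃ k, hF.picard k = k := ⟨_, hF.contractingWith_picard.fixedPoint_isFixedPt⟩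
  have hkexp : (fun s => (k s : ℝ)) = expAverage Λ (hF.forcing k) :=
    funext fun s => congrArg (fun g : ℝ →ᵇ Icc lo hi => (g s : ℝ)) hk.symm
  refine ⟨fun s => k s, fun s => (k s).2, fun s => ?_⟩
  have hderiv := hasDerivAt_expAverage (hF.pos.trans_le hF.le) (hF.forcing k) s
  rw [← hkexp] at hderiv
  exact hderiv.congr_deriv (add_sub_cancel_right _ _)

end IsDissipative

end Dissipative

section Autonomous

section Growth

variable {g g' : ℝ → ℝ} {m : ℝ}

lemma mul_le_sub_of_le_hasDerivAt (hg : ∀ x, HasDerivAt g (g' x) x) (hm : ∀ x, m ≤ g' x) {x y : ℝ}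
    (hxy : x ≤ y) : m * (y - x) ≤ g y - g x :=
  mul_sub_le_image_sub_of_le_deriv (fun x => (hg x).differentiableAt)
    (fun x => (hg x).deriv ▸ hm x) hxy

lemma tendsto_atTop_of_le_hasDerivAt (hm₀ : 0 < m) (hg : ∀ x, HasDerivAt g (g' x) x)
    (hm : ∀ x, m ≤ g' x) : Tendsto g atTop atTop := by
  refine tendsto_atTop_mono' _ ?_
    (tendsto_atTop_add_const_left _ (g 0) (tendsto_id.const_mul_atTop hm₀))
  filter_upwards [eventually_ge_atTop 0] with x hx
  have := mul_le_sub_of_le_hasDerivAt hg hm hx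
  simp only [id]
  linarith

lemma tendsto_atBot_of_le_hasDerivAt (hm₀ : 0 < m) (hg : ∀ x, HasDerivAt g (g' x) x)
    (hm : ∀ x, m ≤ g' x) : Tendsto g atBot atBot := by
  refine tendsto_atBot_mono' _ ?_
    (tendsto_atBot_add_const_left _ (g 0) (tendsto_id.const_mul_atBot hm₀))
  filter_upwards [eventually_le_atBot 0] with x hx
  have := mul_le_sub_of_le_hasDerivAt hg hm hx
  simp only [id]
  linarith

end Growth

-- Separation of variables: `S` is the inverse of a primitive of `1 / k`.
lemma exists_autonomous_solution {k : ℝ → ℝ} {K : ℝ} (hk : Continuous k)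
    (hmem : ∀ s, k s ∈ Ioc 0 K) : ∃ S : ℝ → ℝ, ∀ η, HasDerivAt S (k (S η)) η := by
  have hK : 0 < K := (hmem 0).1.trans_le (hmem 0).2
  have hkinv : Continuous fun s => (k s)⁻¹ := hk.inv₀ fun s => (hmem s).1.ne'
  let τ : ℝ → ℝ := fun s => ∫ r in (0 : ℝ)..s, (k r)⁻¹
  have hτ : ∀ s, HasDerivAt τ (k s)⁻¹ s := fun s => (hkinv.integral_hasStrictDerivAt 0 s).hasDerivAt
  have hle : ∀ s, K⁻¹ ≤ (k s)⁻¹ := fun s => inv_anti₀ (hmem s).1 (hmem s).2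
  have hcont : Continuous τ := continuous_iff_continuousAt.2 fun s => (hτ s).continuousAt
  let e : ℝ ≃o ℝ :=
    (strictMono_of_hasDerivAt_pos hτ fun s => inv_pos.2 (hmem s).1).orderIsoOfSurjective τ
      (hcont.surjective (tendsto_atTop_of_le_hasDerivAt (inv_pos.2 hK) hτ hle)
        (tendsto_atBot_of_le_hasDerivAt (inv_pos.2 hK) hτ hle))
  refine ⟨e.symm, fun η => ?_⟩
  simpa using (hτ (e.symm η)).of_local_left_inverse e.symm.continuous.continuousAt
    (inv_ne_zero (hmem _).1.ne') (.of_forall fun η => e.apply_symm_apply η)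

end Autonomous

section Logistic

/-- The logistic profile `a / (1 + exp (a s))`, decreasing from `a` to `0`. -/
noncomputable def logistic (a s : ℝ) : ℝ := a * Real.sigmoid (-(a * s))

lemma hasDerivAt_logistic (a s : ℝ) :
    HasDerivAt (logistic a) (-(logistic a s * (a - logistic a s))) s := by
  have hinner : HasDerivAt (fun s => -(a * s)) (-a) s := by
    simpa using ((hasDerivAt_id s).const_mul a).fun_neg
  refine (((Real.hasDerivAt_sigmoid _).comp s hinner).const_mul a).congr_deriv ?_
  unfold logistic
  ring

lemma continuous_logistic (a : ℝ) : Continuous (logistic a) :=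
  continuous_iff_continuousAt.2 fun s => (hasDerivAt_logistic a s).continuousAt

variable {a : ℝ} (ha : 0 < a)

include ha

lemma logistic_mem_Ioo (s : ℝ) : logistic a s ∈ Ioo 0 a :=
  ⟨mul_pos ha (Real.sigmoid_pos _), mul_lt_of_lt_one_right ha (Real.sigmoid_lt_one _)⟩

lemma logistic_le_exp (s : ℝ) : logistic a s ≤ a * Real.exp (-(a * s)) := by
  rw [logistic, ← Real.sigmoid_mul_rexp_neg]
  gcongr
  exact mul_le_of_le_one_left (Real.exp_pos _).le (Real.sigmoid_le_one _)

lemma tendsto_logistic_atTop : Tendsto (logistic a) atTop (𝓝 0) := by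
  unfold logistic
  simpa [Function.comp_def] using (Real.tendsto_sigmoid_atBot.comp
    (tendsto_neg_atTop_atBot.comp (tendsto_id.const_mul_atTop ha))).const_mul a

lemma tendsto_logistic_atBot : Tendsto (logistic a) atBot (𝓝 a) := by
  unfold logistic
  simpa [Function.comp_def] using (Real.tendsto_sigmoid_atTop.comp
    (tendsto_neg_atBot_atTop.comp (tendsto_id.const_mul_atBot ha))).const_mul a

lemma strictAnti_logistic : StrictAnti (logistic a) := fun s t hst => by
  unfold logistic
  gcongr

end Logistic

section WZero

variable {f : ℝ → ℝ} {a : ℝ}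

lemma wZero_quadratic (h : 0 ≤ f 0 ^ 2 - 2 * a ^ 2) :
    wZero f a ^ 2 + f 0 * wZero f a + a ^ 2 / 2 = 0 := by
  unfold wZero
  linear_combination Real.sq_sqrt h / 4

lemma discrim_pos (ha : 0 < a) (hfa : 2 * a ≤ f 0) : 0 < f 0 ^ 2 - 2 * a ^ 2 := by
  nlinarith

lemma wZero_neg (ha : 0 < a) (hfa : 2 * a ≤ f 0) : wZero f a < 0 := by
  have hsqrt : Real.sqrt (f 0 ^ 2 - 2 * a ^ 2) < f 0 := by
    rw [Real.sqrt_lt' (by linarith)]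
    nlinarith
  unfold wZero
  linarith

lemma neg_half_le_wZero (ha : 0 < a) (hfa : 2 * a ≤ f 0) : -(a / 2) ≤ wZero f a := by
  have hsqrt : f 0 - a ≤ Real.sqrt (f 0 ^ 2 - 2 * a ^ 2) := Real.le_sqrt_of_sq_le (by nlinarith)
  unfold wZero
  linarith

lemma add_mul_wZero_pos {n : ℕ} (ha : 0 < a) (hfa : (n + 3) * a ≤ f 0) :
    0 < f 0 + (n + 3) * wZero f a := by
  have hna : 0 ≤ n * a := by positivity
  have := mul_le_mul_of_nonneg_left (neg_half_le_wZero ha (by linarith))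
    (by positivity : (0 : ℝ) ≤ n + 3)
  linarith

lemma add_mul_wZero_pos_of_le {k n : ℕ} (hw₀ : wZero f a ≤ 0)
    (hn : 0 < f 0 + (n + 3) * wZero f a) (hk : k ≤ n) : 0 < f 0 + (k + 3) * wZero f a := by
  have hk' : (k : ℝ) + 3 ≤ n + 3 := by gcongr
  linarith [mul_le_mul_of_nonpos_right hk' hw₀]

end WZero

section Slope

/-- Along an orbit written as `W = -(a - V) k` and parametrized by the time of the logistic profile
`V`, the slope `k` solves `k' = slopeField f a V k`. -/
noncomputable def slopeField (f : ℝ → ℝ) (a v k : ℝ) : ℝ :=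
  (a - 2 * v) * k - f v + (a + v) / (2 * k)

variable {f : ℝ → ℝ} {a v k k' κ : ℝ}

lemma slopeField_sub (hk : k ≠ 0) (hk' : k' ≠ 0) :
    slopeField f a v k' - slopeField f a v k =
      (a - 2 * v - (a + v) / (2 * (k * k'))) * (k' - k) := by
  unfold slopeField
  field_simp
  ring

lemma slopeFactor_le_neg (ha : 0 ≤ a) (hv : 0 ≤ v) (hk : k ∈ Ioc 0 (1 / 2))
    (hk' : k' ∈ Ioc 0 (1 / 2)) : a - 2 * v - (a + v) / (2 * (k * k')) ≤ -a := by
  have hkk' : 0 < k * k' := mul_pos hk.1 hk'.1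
  have hprod : k * k' ≤ 1 / 2 * (1 / 2) := mul_le_mul hk.2 hk'.2 hk'.1.le (by norm_num)
  have hdiv : 2 * (a + v) ≤ (a + v) / (2 * (k * k')) := by
    rw [le_div_iff₀ (by positivity)]
    nlinarith
  linarith

lemma neg_le_slopeFactor (hκ : 0 < κ) (hv : v ∈ Icc 0 a) (hk : κ ≤ k) (hk' : κ ≤ k') :
    -(a + a / κ ^ 2) ≤ a - 2 * v - (a + v) / (2 * (k * k')) := by
  have ha : 0 ≤ a := hv.1.trans hv.2
  have hk₀ : 0 ≤ k := hκ.le.trans hk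
  have hdiv : (a + v) / (2 * (k * k')) ≤ (2 * a) / (2 * (κ * κ)) := by
    gcongr
    linarith [hv.2]
  rw [mul_div_mul_left _ _ two_ne_zero, ← sq] at hdiv
  linarith [hv.2]

lemma isDissipative_slopeField {V : ℝ → ℝ} {M : ℝ} (ha : 0 < a) (hf : Continuous f)
    (hV : Continuous V) (hVmem : ∀ s, V s ∈ Icc 0 a) (hfmem : ∀ x ∈ Icc 0 a, f x ∈ Icc (2 * a) M) :
    IsDissipative (fun s => slopeField f a (V s)) (a / (4 * M)) (1 / 2) a
      (a + a / (a / (4 * M)) ^ 2) := by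
  have hM : 2 * a ≤ M := (hfmem 0 ⟨le_rfl, ha.le⟩).1.trans (hfmem 0 ⟨le_rfl, ha.le⟩).2
  have hM₀ : 0 < M := by linarith
  set κ := a / (4 * M) with hκ_def
  have hκ : 0 < κ := by positivity
  have hκM : a = 4 * M * κ := by rw [hκ_def]; field_simp
  have hpos : ∀ k ∈ Icc κ (1 / 2), k ∈ Ioc 0 (1 / 2) := fun k hk => ⟨hκ.trans_le hk.1, hk.2⟩
  refine ⟨ha, le_add_of_nonneg_right (by positivity), ?_, fun s => ?_, fun s => ?_,
    fun s k hk k' hk' hkk' => ?_⟩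
  · have hne : ∀ p ∈ univ ×ˢ Icc κ (1 / 2), 2 * (p : ℝ × ℝ).2 ≠ 0 := fun p hp =>
      mul_ne_zero two_ne_zero (hpos _ hp.2).1.ne'
    simp only [Function.uncurry_def, slopeField]
    fun_prop (disch := assumption)
  · have hfV := (hfmem _ (hVmem s)).2
    have hdiv : 2 * M ≤ (a + V s) / (2 * κ) := by
      rw [le_div_iff₀ (by positivity)]
      linarith [(hVmem s).1]
    have hlin : -a * κ ≤ (a - 2 * V s) * κ := by
      gcongr
      linarith [(hVmem s).2]
    have haκ : a * κ ≤ M := by nlinarith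
    unfold slopeField
    linarith
  · have hfV := (hfmem _ (hVmem s)).1
    norm_num [slopeField]
    linarith
  · rw [slopeField_sub (hpos k hk).1.ne' (hpos k' hk').1.ne', neg_mul, neg_mul, ← neg_mul,
      ← neg_mul]
    have hsub := sub_nonneg.2 hkk'
    exact ⟨mul_le_mul_of_nonneg_right (neg_le_slopeFactor hκ (hVmem s) hk.1 hk'.1) hsub,
      mul_le_mul_of_nonneg_right
        (slopeFactor_le_neg ha.le (hVmem s).1 (hpos k hk) (hpos k' hk')) hsub⟩

lemma exists_slope {V : ℝ → ℝ} (ha : 0 < a) (hf : Continuous f) (hV : Continuous V)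
    (hVmem : ∀ s, V s ∈ Icc 0 a) (hfa : ∀ x ∈ Icc 0 a, 2 * a ≤ f x) :
    ∃ κ > 0, ∃ k : ℝ → ℝ, (∀ s, k s ∈ Icc κ (1 / 2)) ∧
      ∀ s, HasDerivAt k (slopeField f a (V s) (k s)) s := by
  obtain ⟨M, hM⟩ := isCompact_Icc.bddAbove_image (hf.continuousOn (s := Icc 0 a))
  have hfmem : ∀ x ∈ Icc 0 a, f x ∈ Icc (2 * a) M := fun x hx => ⟨hfa x hx, hM ⟨x, hx, rfl⟩⟩
  have hM_ge : 2 * a ≤ M := (hfmem 0 ⟨le_rfl, ha.le⟩).1.trans (hfmem 0 ⟨le_rfl, ha.le⟩).2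
  have hM₀ : 0 < 4 * M := by linarith
  refine ⟨a / (4 * M), div_pos ha hM₀,
    (isDissipative_slopeField ha hf hV hVmem hfmem).exists_solution ?_⟩
  rw [div_le_div_iff₀ hM₀ two_pos]
  linarith

lemma slopeField_root (ha : 0 < a) (hfa : 2 * a ≤ f 0) :
    slopeField f a 0 (-wZero f a / a) = 0 := by
  have hw := (wZero_neg ha hfa).ne
  unfold slopeField
  field_simp
  linear_combination -2 * a * wZero_quadratic (discrim_pos ha hfa).le

lemma root_mem_Ioc (ha : 0 < a) (hfa : 2 * a ≤ f 0) : -wZero f a / a ∈ Ioc 0 (1 / 2) := by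
  refine ⟨div_pos (neg_pos.2 (wZero_neg ha hfa)) ha, ?_⟩
  rw [div_le_iff₀ ha]
  linarith [neg_half_le_wZero ha hfa]

lemma tendsto_slope_atTop {V k : ℝ → ℝ} (ha : 0 < a) (hf : Continuous f) (hfa : 2 * a ≤ f 0)
    (hVnonneg : ∀ s, 0 ≤ V s) (hV : Tendsto V atTop (𝓝 0)) (hkmem : ∀ s, k s ∈ Ioc 0 (1 / 2))
    (hk : ∀ s, HasDerivAt k (slopeField f a (V s) (k s)) s) :
    Tendsto k atTop (𝓝 (-wZero f a / a)) := by
  have hl := root_mem_Ioc ha hfa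
  have hroot := slopeField_root ha hfa
  set l := -wZero f a / a
  have hforcing : Tendsto (fun s => slopeField f a (V s) l) atTop (𝓝 0) := by
    have hcont : Continuous fun v => slopeField f a v l := by unfold slopeField; fun_prop
    simpa only [hroot, Function.comp_def] using (hcont.tendsto 0).comp hV
  have hdiff : Tendsto (fun s => k s - l) atTop (𝓝 0) := by
    refine tendsto_zero_of_damped ha
      (α := fun s => -(a - 2 * V s - (a + V s) / (2 * (l * k s))))
      (.of_forall fun s => ((hk s).sub_const l).congr_deriv ?_)
      (.of_forall fun s => le_neg.1 (slopeFactor_le_neg ha.le (hVnonneg s) hl (hkmem s))) hforcing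
    rw [neg_neg, ← slopeField_sub hl.1.ne' (hkmem s).1.ne', sub_add_cancel]
  simpa using hdiff.add_const l

end Slope

section Orbit

variable {f : ℝ → ℝ} {a : ℝ}

lemma solvesReg_of_slope {k S : ℝ → ℝ}
    (hk : ∀ s, HasDerivAt k (slopeField f a (logistic a s) (k s)) s) (hk₀ : ∀ s, k s ≠ 0)
    (hS : ∀ η, HasDerivAt S (k (S η)) η) :
    SolvesReg f a (logistic a ∘ S) fun η => -((a - logistic a (S η)) * k (S η)) := by
  intro η
  have hV := (hasDerivAt_logistic a (S η)).comp η (hS η)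
  have hW := ((hV.const_sub a).mul ((hk (S η)).comp η (hS η))).neg
  refine ⟨hV.congr_deriv ?_, hW.congr_deriv ?_⟩
  · simp only [Function.comp_apply]
    ring
  · have := hk₀ (S η)
    simp only [Function.comp_apply, slopeField]
    field_simp
    ring

lemma expDecay_logistic_comp {S S' : ℝ → ℝ} {κ : ℝ} (ha : 0 < a) (hκ : 0 < κ)
    (hS : ∀ η, HasDerivAt S (S' η) η) (hS' : ∀ η, κ ≤ S' η) : ExpDecay (logistic a ∘ S) := by
  refine ⟨a * Real.exp (-(a * S 0)), a * κ, mul_pos ha hκ, fun η hη => ?_⟩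
  rw [Function.comp_apply, abs_of_pos (logistic_mem_Ioo ha _).1, mul_assoc, ← Real.exp_add]
  refine (logistic_le_exp ha _).trans ?_
  gcongr
  have := mul_le_mul_of_nonneg_left (mul_le_sub_of_le_hasDerivAt hS hS' hη) ha.le
  linarith

lemma exists_isFlat (hf : Continuous f) (ha : 0 < a) (hfa : ∀ x ∈ Icc 0 a, 2 * a ≤ f x) :
    ∃ V W, IsFlat f a V W := by
  obtain ⟨κ, hκ, k, hkmem, hk⟩ := exists_slope ha hf (continuous_logistic a)
    (fun s => Ioo_subset_Icc_self (logistic_mem_Ioo ha s)) hfa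
  have hkpos : ∀ s, k s ∈ Ioc 0 (1 / 2) := fun s => ⟨hκ.trans_le (hkmem s).1, (hkmem s).2⟩
  obtain ⟨S, hS⟩ := exists_autonomous_solution
    (continuous_iff_continuousAt.2 fun s => (hk s).continuousAt) hkpos
  have hS_le : ∀ η, κ ≤ k (S η) := fun η => (hkmem _).1
  have hS_top : Tendsto S atTop atTop := tendsto_atTop_of_le_hasDerivAt hκ hS hS_le
  have hV_bot : Tendsto (logistic a ∘ S) atBot (𝓝 a) :=
    (tendsto_logistic_atBot ha).comp (tendsto_atBot_of_le_hasDerivAt hκ hS hS_le)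
  have hV_top : Tendsto (logistic a ∘ S) atTop (𝓝 0) := (tendsto_logistic_atTop ha).comp hS_top
  have hk_top : Tendsto k atTop (𝓝 (-wZero f a / a)) :=
    tendsto_slope_atTop ha hf (hfa 0 ⟨le_rfl, ha.le⟩) (fun s => (logistic_mem_Ioo ha s).1.le)
      (tendsto_logistic_atTop ha) hkpos hk
  refine ⟨_, _, solvesReg_of_slope hk (fun s => (hkpos s).1.ne') hS, hV_bot, ?_, hV_top, ?_,
    (strictAnti_logistic ha).comp_strictMono
      (strictMono_of_hasDerivAt_pos hS fun η => (hkpos _).1),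
    expDecay_logistic_comp ha hκ hS hS_le⟩
  · have hbdd : IsBoundedUnder (· ≤ ·) atBot (norm ∘ fun η => k (S η)) :=
      isBoundedUnder_of ⟨1 / 2, fun η => by
        simpa [abs_of_pos (hkpos (S η)).1] using (hkpos (S η)).2⟩
    have hdiff : Tendsto (fun η => a - logistic a (S η)) atBot (𝓝 0) := by
      simpa using hV_bot.const_sub a
    simpa using (hdiff.zero_mul_isBoundedUnder_le hbdd).neg
  · have hlim := ((hV_top.const_sub a).mul (hk_top.comp hS_top)).neg
    rwa [sub_zero, mul_div_cancel₀ _ ha.ne', neg_neg] at hlim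

lemma wZero_comp_neg (f : ℝ → ℝ) (a : ℝ) : wZero (fun x => f (-x)) a = wZero f a := by
  simp only [wZero, neg_zero]

lemma IsFlat.isSharp_neg {V W : ℝ → ℝ} (h : IsFlat (fun x => f (-x)) a V W) :
    IsSharp f a (-V) W := by
  refine ⟨fun η => ⟨(h.solves η).1.neg.congr_deriv (neg_mul _ _).symm,
    (h.solves η).2.congr_deriv (by simp)⟩, h.V_atBot.neg, h.W_atBot,
    neg_zero (G := ℝ) ▸ h.V_atTop.neg,
    wZero_comp_neg f a ▸ h.W_atTop, h.anti.neg, ?_⟩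
  obtain ⟨C, c, hc, hC⟩ := h.decay
  exact ⟨C, c, hc, by simpa using hC⟩

lemma IsSharp.isFlat_neg {V W : ℝ → ℝ} (h : IsSharp f a V W) :
    IsFlat (fun x => f (-x)) a (-V) W := by
  refine ⟨fun η => ⟨(h.solves η).1.neg.congr_deriv (neg_mul _ _).symm,
    (h.solves η).2.congr_deriv (by simp)⟩, neg_neg a ▸ h.V_atBot.neg, h.W_atBot,
    neg_zero (G := ℝ) ▸ h.V_atTop.neg,
    (wZero_comp_neg f a).symm ▸ h.W_atTop, h.mono.neg, ?_⟩
  obtain ⟨C, c, hc, hC⟩ := h.decay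
  exact ⟨C, c, hc, by simpa using hC⟩

lemma exists_isSharp (hf : Continuous f) (ha : 0 < a) (hfa : ∀ x ∈ Icc (-a) 0, 2 * a ≤ f x) :
    ∃ V W, IsSharp f a V W := by
  obtain ⟨V, W, h⟩ := exists_isFlat (f := fun x => f (-x)) (hf.comp continuous_neg) ha
    fun x hx => hfa _ ⟨neg_le_neg hx.2, neg_nonpos.2 hx.1⟩
  exact ⟨_, _, h.isSharp_neg⟩

end Orbit

section ChangeOfVariable

open Function (invFun)
open MeasureTheory (IntegrableOn)

variable {f V W : ℝ → ℝ} {a ξ : ℝ}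

namespace IsFlat

lemma pos (h : IsFlat f a V W) (η : ℝ) : 0 < V η :=
  (h.anti.antitone.le_of_tendsto h.V_atTop (η + 1)).trans_lt (h.anti (lt_add_one η))

lemma lt (h : IsFlat f a V W) (η : ℝ) : V η < a :=
  (h.anti (sub_one_lt η)).trans_le (h.anti.antitone.ge_of_tendsto h.V_atBot (η - 1))

lemma continuous (h : IsFlat f a V W) : Continuous V :=
  continuous_iff_continuousAt.2 fun η => (h.solves η).1.continuousAt

lemma integrableOn_Ioi (h : IsFlat f a V W) (η : ℝ) : IntegrableOn V (Ioi η) := by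
  obtain ⟨C, c, hc, hC⟩ := h.decay
  refine integrable_of_isBigO_exp_neg hc h.continuous.continuousOn (.of_bound C ?_)
  filter_upwards [eventually_ge_atTop 0] with η hη
  rw [Real.norm_eq_abs, Real.norm_eq_abs, Real.abs_exp]
  exact hC η hη

lemma Xi_eq_add_integral (h : IsFlat f a V W) (η : ℝ) :
    Xi V η = Xi V 0 + ∫ ζ in (0 : ℝ)..η, V ζ := by
  have := intervalIntegral.integral_interval_add_Ioi (h.integrableOn_Ioi 0) (h.integrableOn_Ioi η)
  simp only [Xi]
  linarith

lemma hasDerivAt_Xi (h : IsFlat f a V W) (η : ℝ) : HasDerivAt (Xi V) (V η) η :=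
  ((h.continuous.integral_hasStrictDerivAt 0 η).hasDerivAt.const_add (Xi V 0)).congr_of_eventuallyEq
    (.of_forall h.Xi_eq_add_integral)

lemma strictMono_Xi (h : IsFlat f a V W) : StrictMono (Xi V) :=
  strictMono_of_hasDerivAt_pos h.hasDerivAt_Xi h.pos

lemma tendsto_Xi_atTop (h : IsFlat f a V W) : Tendsto (Xi V) atTop (𝓝 0) := by
  have hlim := (MeasureTheory.intervalIntegral_tendsto_integral_Ioi 0 (h.integrableOn_Ioi 0)
    tendsto_id).const_add (Xi V 0)
  rw [Xi, neg_add_cancel] at hlim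
  exact hlim.congr fun η => (h.Xi_eq_add_integral η).symm

lemma tendsto_Xi_atBot (h : IsFlat f a V W) : Tendsto (Xi V) atBot atBot := by
  have hle : ∀ η ≤ 0, Xi V η ≤ Xi V 0 + V 0 * η := fun η hη => by
    have := (convex_Iic (0 : ℝ)).mul_sub_le_image_sub_of_le_deriv (C := V 0)
      (fun x _ => (h.hasDerivAt_Xi x).continuousAt.continuousWithinAt)
      (fun x _ => (h.hasDerivAt_Xi x).differentiableAt.differentiableWithinAt)
      (fun x hx => (h.hasDerivAt_Xi x).deriv ▸ h.anti.antitone (interior_subset hx : x ∈ Iic 0))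
      η hη 0 self_mem_Iic hη
    linarith
  exact tendsto_atBot_mono' _ ((eventually_le_atBot 0).mono hle)
    (tendsto_atBot_add_const_left _ _ (tendsto_id.const_mul_atBot (h.pos 0)))

lemma Xi_lt_zero (h : IsFlat f a V W) (η : ℝ) : Xi V η < 0 :=
  (h.strictMono_Xi (lt_add_one η)).trans_le
    (h.strictMono_Xi.monotone.ge_of_tendsto h.tendsto_Xi_atTop (η + 1))

lemma bijOn_Xi (h : IsFlat f a V W) : BijOn (Xi V) univ (Iio 0) := by
  refine ⟨fun η _ => h.Xi_lt_zero η, h.strictMono_Xi.injective.injOn, fun ξ (hξ : ξ < 0) => ?_⟩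
  rw [image_univ]
  exact mem_range_of_exists_le_of_exists_ge
    (continuous_iff_continuousAt.2 fun η => (h.hasDerivAt_Xi η).continuousAt)
    (h.tendsto_Xi_atBot.eventually_le_atBot ξ).exists
    (h.tendsto_Xi_atTop.eventually_const_le hξ).exists

lemma Xi_invFun (h : IsFlat f a V W) (hξ : ξ < 0) : Xi V (invFun (Xi V) ξ) = ξ :=
  let ⟨η, _, hη⟩ := h.bijOn_Xi.surjOn hξ
  Function.invFun_eq ⟨η, hη⟩

lemma invFun_Xi (h : IsFlat f a V W) (η : ℝ) : invFun (Xi V) (Xi V η) = η :=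
  Function.leftInverse_invFun h.strictMono_Xi.injective η

lemma strictMonoOn_invFun_Xi (h : IsFlat f a V W) : StrictMonoOn (invFun (Xi V)) (Iio 0) := by
  intro x hx y hy hxy
  rwa [← h.strictMono_Xi.lt_iff_lt, h.Xi_invFun hx, h.Xi_invFun hy]

lemma hasDerivAt_invFun_Xi (h : IsFlat f a V W) (hξ : ξ < 0) :
    HasDerivAt (invFun (Xi V)) (V (invFun (Xi V) ξ))⁻¹ ξ := by
  have himage : invFun (Xi V) '' Iio 0 = univ :=
    eq_univ_of_forall fun η => ⟨Xi V η, h.Xi_lt_zero η, h.invFun_Xi η⟩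
  refine (h.hasDerivAt_Xi _).of_local_left_inverse ?_ (h.pos _).ne' ?_
  · exact h.strictMonoOn_invFun_Xi.continuousAt_of_image_mem_nhds (Iio_mem_nhds hξ)
      (himage ▸ univ_mem)
  · filter_upwards [Iio_mem_nhds hξ] with x hx using h.Xi_invFun hx

lemma tendsto_invFun_Xi_atBot (h : IsFlat f a V W) : Tendsto (invFun (Xi V)) atBot atBot := by
  refine tendsto_atBot.2 fun N => ?_
  filter_upwards [eventually_le_atBot (Xi V N)] with ξ hξ
  rwa [← h.strictMono_Xi.le_iff_le, h.Xi_invFun (hξ.trans_lt (h.Xi_lt_zero N))]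

lemma tendsto_invFun_Xi_nhdsLT (h : IsFlat f a V W) :
    Tendsto (invFun (Xi V)) (𝓝[<] 0) atTop := by
  refine tendsto_atTop.2 fun N => ?_
  filter_upwards [self_mem_nhdsWithin,
    mem_nhdsWithin_of_mem_nhds (Ioi_mem_nhds (h.Xi_lt_zero N))] with ξ hξ hN
  rw [← h.strictMono_Xi.le_iff_le, h.Xi_invFun hξ]
  exact le_of_lt hN

end IsFlat

lemma Xi_neg (V : ℝ → ℝ) (η : ℝ) : Xi (-V) η = -Xi V η := by
  simp only [Xi, Pi.neg_apply, MeasureTheory.integral_neg]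

namespace IsSharp

lemma neg (h : IsSharp f a V W) (η : ℝ) : V η < 0 := neg_pos.1 (h.isFlat_neg.pos η)

lemma lt (h : IsSharp f a V W) (η : ℝ) : -a < V η := neg_lt.1 (h.isFlat_neg.lt η)

lemma bijOn_Xi (h : IsSharp f a V W) : BijOn (Xi V) univ (Ioi 0) := by
  have hbij : BijOn (-Xi V) univ (Iio 0) :=
    h.isFlat_neg.bijOn_Xi.congr fun η _ => Xi_neg V η
  refine ⟨fun η _ => neg_lt_zero (α := ℝ) |>.1 (hbij.mapsTo (mem_univ η)),
    fun x hx y hy hxy => hbij.injOn hx hy (congrArg Neg.neg hxy), fun ξ (hξ : 0 < ξ) => ?_⟩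
  obtain ⟨η, hη, hηξ⟩ := hbij.surjOn (show -ξ ∈ Iio 0 from neg_lt_zero.2 hξ)
  exact ⟨η, hη, neg_inj.1 hηξ⟩

lemma invFun_Xi_eq (h : IsSharp f a V W) (hξ : 0 < ξ) :
    invFun (Xi V) ξ = invFun (Xi (-V)) (-ξ) := by
  obtain ⟨η, -, rfl⟩ := h.bijOn_Xi.surjOn hξ
  rw [Function.leftInverse_invFun (injOn_univ.1 h.bijOn_Xi.injOn) η, ← Xi_neg,
    h.isFlat_neg.invFun_Xi]

lemma hasDerivAt_invFun_Xi (h : IsSharp f a V W) (hξ : 0 < ξ) :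
    HasDerivAt (invFun (Xi V)) (V (invFun (Xi V) ξ))⁻¹ ξ := by
  have hev : invFun (Xi V) =ᶠ[𝓝 ξ] invFun (Xi (-V)) ∘ Neg.neg := by
    filter_upwards [Ioi_mem_nhds hξ] with x hx using h.invFun_Xi_eq hx
  have hderiv := (h.isFlat_neg.hasDerivAt_invFun_Xi (neg_lt_zero.2 hξ)).comp ξ (hasDerivAt_neg ξ)
  refine (hderiv.congr_of_eventuallyEq hev).congr_deriv ?_
  rw [h.invFun_Xi_eq hξ, Pi.neg_apply, inv_neg, neg_mul_neg, mul_one]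

lemma tendsto_invFun_Xi_atTop (h : IsSharp f a V W) : Tendsto (invFun (Xi V)) atTop atBot := by
  refine (h.isFlat_neg.tendsto_invFun_Xi_atBot.comp tendsto_neg_atTop_atBot).congr' ?_
  filter_upwards [eventually_gt_atTop 0] with ξ hξ using (h.invFun_Xi_eq hξ).symm

lemma tendsto_invFun_Xi_nhdsGT (h : IsSharp f a V W) :
    Tendsto (invFun (Xi V)) (𝓝[>] 0) atTop := by
  have hneg : Tendsto Neg.neg (𝓝[>] (0 : ℝ)) (𝓝[<] 0) := by
    simpa only [neg_zero] using tendsto_neg_nhdsGT (a := (0 : ℝ))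
  refine (h.isFlat_neg.tendsto_invFun_Xi_nhdsLT.comp hneg).congr' ?_
  filter_upwards [self_mem_nhdsWithin] with ξ hξ using (h.invFun_Xi_eq hξ).symm

end IsSharp

lemma SolvesReg.hasDerivAt_comp (hs : SolvesReg f a V W) {η : ℝ → ℝ}
    (hη : HasDerivAt η (V (η ξ))⁻¹ ξ) (hne : V (η ξ) ≠ 0) :
    HasDerivAt (V ∘ η) (W (η ξ)) ξ ∧
      HasDerivAt (W ∘ η) (transverseField f a (V (η ξ)) (W (η ξ)) / V (η ξ)) ξ :=
  ⟨((hs (η ξ)).1.comp ξ hη).congr_deriv (by field_simp),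
    (hs (η ξ)).2.comp ξ hη⟩

end ChangeOfVariable

section Gluing

open Function (invFun)

section

variable {V₁ V₂ G₁ G₂ : ℝ → ℝ} {z ξ : ℝ}

lemma glue_of_neg (h : ξ < 0) : glue V₁ V₂ G₁ G₂ z ξ = G₁ (invFun (Xi V₁) ξ) := if_pos h

lemma glue_of_pos (h : 0 < ξ) : glue V₁ V₂ G₁ G₂ z ξ = G₂ (invFun (Xi V₂) ξ) := by
  rw [glue, if_neg h.not_gt, if_pos h]

lemma glue_zero : glue V₁ V₂ G₁ G₂ z 0 = z := by
  rw [glue, if_neg (lt_irrefl _), if_neg (lt_irrefl _)]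

lemma glue_eventuallyEq_of_neg (h : ξ < 0) :
    glue V₁ V₂ G₁ G₂ z =ᶠ[𝓝 ξ] G₁ ∘ invFun (Xi V₁) :=
  eventually_of_mem (Iio_mem_nhds h) fun _ hx => glue_of_neg hx

lemma glue_eventuallyEq_of_pos (h : 0 < ξ) :
    glue V₁ V₂ G₁ G₂ z =ᶠ[𝓝 ξ] G₂ ∘ invFun (Xi V₂) :=
  eventually_of_mem (Ioi_mem_nhds h) fun _ hx => glue_of_pos hx

end

variable {f V₁ W₁ V₂ W₂ G₁ G₂ : ℝ → ℝ} {a z l : ℝ}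

lemma continuousAt_glue_zero (hF : IsFlat f a V₁ W₁) (hS : IsSharp f a V₂ W₂)
    (h₁ : Tendsto G₁ atTop (𝓝 z)) (h₂ : Tendsto G₂ atTop (𝓝 z)) :
    ContinuousAt (glue V₁ V₂ G₁ G₂ z) 0 := by
  rw [← continuousWithinAt_compl_self, ContinuousWithinAt, glue_zero, ← Iio_union_Ioi,
    nhdsWithin_union, tendsto_sup]
  constructor
  · refine (h₁.comp hF.tendsto_invFun_Xi_nhdsLT).congr' ?_
    filter_upwards [self_mem_nhdsWithin] with x hx using (glue_of_neg hx).symm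
  · refine (h₂.comp hS.tendsto_invFun_Xi_nhdsGT).congr' ?_
    filter_upwards [self_mem_nhdsWithin] with x hx using (glue_of_pos hx).symm

lemma tendsto_glue_atBot (hF : IsFlat f a V₁ W₁) (h : Tendsto G₁ atBot (𝓝 l)) :
    Tendsto (glue V₁ V₂ G₁ G₂ z) atBot (𝓝 l) := by
  refine (h.comp hF.tendsto_invFun_Xi_atBot).congr' ?_
  filter_upwards [eventually_lt_atBot 0] with x hx using (glue_of_neg hx).symm

lemma tendsto_glue_atTop (hS : IsSharp f a V₂ W₂) (h : Tendsto G₂ atBot (𝓝 l)) :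
    Tendsto (glue V₁ V₂ G₁ G₂ z) atTop (𝓝 l) := by
  refine (h.comp hS.tendsto_invFun_Xi_atTop).congr' ?_
  filter_upwards [eventually_gt_atTop 0] with x hx using (glue_of_pos hx).symm

lemma glue_mem_Ioo (ha : 0 < a) (hF : IsFlat f a V₁ W₁) (hS : IsSharp f a V₂ W₂) (x : ℝ) :
    glue V₁ V₂ V₁ V₂ 0 x ∈ Ioo (-a) a := by
  rcases lt_trichotomy x 0 with h | rfl | h
  · rw [glue_of_neg h]
    exact ⟨(neg_neg_of_pos ha).trans (hF.pos _), hF.lt _⟩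
  · rw [glue_zero]
    exact ⟨neg_neg_of_pos ha, ha⟩
  · rw [glue_of_pos h]
    exact ⟨hS.lt _, (hS.neg _).trans ha⟩

lemma hasDerivAt_glue_of_ne_zero (hF : IsFlat f a V₁ W₁) (hS : IsSharp f a V₂ W₂) {x : ℝ}
    (hx : x ≠ 0) :
    HasDerivAt (glue V₁ V₂ V₁ V₂ 0) (glue V₁ V₂ W₁ W₂ z x) x ∧
      HasDerivAt (glue V₁ V₂ W₁ W₂ z)
        (transverseField f a (glue V₁ V₂ V₁ V₂ 0 x) (glue V₁ V₂ W₁ W₂ z x) /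
          glue V₁ V₂ V₁ V₂ 0 x) x := by
  rcases hx.lt_or_gt with h | h
  · obtain ⟨hV, hW⟩ := hF.solves.hasDerivAt_comp (hF.hasDerivAt_invFun_Xi h) (hF.pos _).ne'
    rw [glue_of_neg h, glue_of_neg h]
    exact ⟨hV.congr_of_eventuallyEq (glue_eventuallyEq_of_neg h),
      hW.congr_of_eventuallyEq (glue_eventuallyEq_of_neg h)⟩
  · obtain ⟨hV, hW⟩ := hS.solves.hasDerivAt_comp (hS.hasDerivAt_invFun_Xi h) (hS.neg _).ne
    rw [glue_of_pos h, glue_of_pos h]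
    exact ⟨hV.congr_of_eventuallyEq (glue_eventuallyEq_of_pos h),
      hW.congr_of_eventuallyEq (glue_eventuallyEq_of_pos h)⟩

lemma isSonicCrossing_glue (hF : IsFlat f a V₁ W₁) (hS : IsSharp f a V₂ W₂) :
    IsSonicCrossing f a (glue V₁ V₂ V₁ V₂ 0) (glue V₁ V₂ W₁ W₂ (wZero f a)) where
  v_zero := glue_zero
  v_ne_zero x hx := by
    rcases hx.lt_or_gt with h | h
    · exact glue_of_neg h ▸ (hF.pos _).ne'
    · exact glue_of_pos h ▸ (hS.neg _).ne
  w_zero := glue_zero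
  continuousAt_w := continuousAt_glue_zero hF hS hF.W_atTop hS.W_atTop
  hasDerivAt_v := hasDerivAt_of_hasDerivAt_of_ne' (x := 0)
    (fun _ hx => (hasDerivAt_glue_of_ne_zero hF hS hx).1)
    (continuousAt_glue_zero hF hS hF.V_atTop hS.V_atTop)
    (continuousAt_glue_zero hF hS hF.W_atTop hS.W_atTop)
  hasDerivAt_w _ hx := (hasDerivAt_glue_of_ne_zero hF hS hx).2

lemma IsSonicCrossing.mul_deriv_w {v w : ℝ → ℝ} (h : IsSonicCrossing f a v w)
    (hdisc : 0 ≤ f 0 ^ 2 - 2 * a ^ 2) (ξ : ℝ) :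
    v ξ * deriv w ξ = transverseField f a (v ξ) (w ξ) := by
  obtain rfl | hξ := eq_or_ne ξ 0
  · rw [h.v_zero, h.w_zero, transverseField]
    linear_combination wZero_quadratic hdisc
  · rw [(h.hasDerivAt_w ξ hξ).deriv, mul_div_cancel₀ _ (h.v_ne_zero ξ hξ)]

lemma isProfile_glue (ha : 0 < a) (hdisc : 0 ≤ f 0 ^ 2 - 2 * a ^ 2) (hF : IsFlat f a V₁ W₁)
    (hS : IsSharp f a V₂ W₂) (hdiff : Differentiable ℝ (glue V₁ V₂ W₁ W₂ (wZero f a))) :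
    IsProfile f a (glue V₁ V₂ V₁ V₂ 0) (glue V₁ V₂ W₁ W₂ (wZero f a)) where
  hasDeriv_v := (isSonicCrossing_glue hF hS).hasDerivAt_v
  differentiable_w := hdiff
  eq_w := (isSonicCrossing_glue hF hS).mul_deriv_w hdisc
  v_atBot := tendsto_glue_atBot hF hF.V_atBot
  w_atBot := tendsto_glue_atBot hF hF.W_atBot
  v_atTop := tendsto_glue_atTop hS hS.V_atBot
  w_atTop := tendsto_glue_atTop hS hS.W_atBot
  mem := glue_mem_Ioo ha hF hS

end Gluing

section Coefficients

/-- Right-hand side of the recursion for the coefficients `w_k`: the number `b_k` formed from the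
Taylor coefficients `c` of `f` and from `w_0, …, w_k`. -/
noncomputable def sonicRhs (c w : ℕ → ℝ) (k : ℕ) : ℝ :=
  -(∑ i ∈ Finset.range (k + 1), c (i + 1) * w (k - i))
    - (∑ i ∈ Finset.range k, ((i : ℝ) + 2) * w (i + 1) * w (k - i))
    + if k = 1 then 1 / 2 else 0

lemma sonicRhs_congr {c c' w w' : ℕ → ℝ} {k : ℕ} (hc : ∀ i ≤ k, c (i + 1) = c' (i + 1))
    (hw : ∀ i ≤ k, w i = w' i) : sonicRhs c w k = sonicRhs c' w' k := by
  unfold sonicRhs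
  congr! 4 with i hi i hi
  · rw [hc i (Nat.lt_succ_iff.1 (Finset.mem_range.1 hi)), hw _ (Nat.sub_le k i)]
  · rw [hw _ (Finset.mem_range.1 hi)]
  · exact hw _ (Nat.sub_le k i)

/-- The coefficients `w_k` of the expansion at the sonic point, for a function `f` with Taylor
coefficients `c`. The value `0` for `j > k` is never used. -/
noncomputable def sonicCoeff (c : ℕ → ℝ) (w₀ : ℝ) : ℕ → ℝ
  | 0 => w₀
  | k + 1 => sonicRhs c (fun j => if _ : j ≤ k then sonicCoeff c w₀ j else 0) k /
      (c 0 + ((k : ℝ) + 3) * w₀)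

lemma sonicCoeff_zero (c : ℕ → ℝ) (w₀ : ℝ) : sonicCoeff c w₀ 0 = w₀ := by
  rw [sonicCoeff]

lemma sonicCoeff_succ (c : ℕ → ℝ) (w₀ : ℝ) (k : ℕ) :
    sonicCoeff c w₀ (k + 1) =
      sonicRhs c (sonicCoeff c w₀) k / (c 0 + ((k : ℝ) + 3) * w₀) := by
  rw [sonicCoeff,
    sonicRhs_congr (c' := c) (w' := sonicCoeff c w₀) (fun _ _ => rfl) fun i hi => dif_pos hi]

/-- Taylor coefficients of `f` at `0`. -/
noncomputable def taylorCoeff (f : ℝ → ℝ) (i : ℕ) : ℝ := iteratedDeriv i f 0 / (i.factorial : ℝ)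

lemma taylorCoeff_zero (f : ℝ → ℝ) : taylorCoeff f 0 = f 0 := by
  simp only [taylorCoeff, iteratedDeriv_zero, Nat.factorial_zero, Nat.cast_one, div_one]

lemma taylorCoeff_one (f : ℝ → ℝ) : taylorCoeff f 1 = deriv f 0 := by
  simp only [taylorCoeff, iteratedDeriv_one, Nat.factorial_one, Nat.cast_one, div_one]

lemma isCoeffs_sonicCoeff {f : ℝ → ℝ} {a : ℝ} {n : ℕ}
    (hne : ∀ k ≤ n, f 0 + ((k : ℝ) + 3) * wZero f a ≠ 0) :
    IsCoeffs f a n (sonicCoeff (taylorCoeff f) (wZero f a))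
      (sonicRhs (taylorCoeff f) (sonicCoeff (taylorCoeff f) (wZero f a))) := by
  have hw₀ := sonicCoeff_zero (taylorCoeff f) (wZero f a)
  have hdenom (k : ℕ) : f 0 + (((k + 1 : ℕ) : ℝ) + 2) * wZero f a =
      f 0 + ((k : ℝ) + 3) * wZero f a := by push_cast; ring
  have hpred : ∀ k ∈ Finset.Icc 1 (n + 1), ∃ l ≤ n, k = l + 1 := fun k hk =>
    ⟨k - 1, by grind, by grind⟩
  have hIcc (g : ℕ → ℝ) (k : ℕ) :
      ∑ i ∈ Finset.Icc 1 k, g i = ∑ i ∈ Finset.range k, g (i + 1) := by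
    rw [Finset.range_eq_Ico, Finset.sum_Ico_add' g 0 k 1]
    rfl
  refine ⟨hw₀, fun k hk => ?_, fun k hk => ?_, ?_, fun _ => ?_, fun k hk => ?_⟩
  · obtain ⟨k, hkn, rfl⟩ := hpred k hk
    rw [hw₀, hdenom]
    exact hne k hkn
  · obtain ⟨k, -, rfl⟩ := hpred k hk
    rw [hw₀, hdenom, sonicCoeff_succ, taylorCoeff_zero, Nat.add_sub_cancel]
  · simp [sonicRhs, taylorCoeff_one]
  · simp [sonicRhs, Finset.sum_range_succ, hw₀, taylorCoeff]
    ring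
  · have hk₁ : k ≠ 1 := by grind
    simp only [sonicRhs, if_neg hk₁, add_zero, hIcc, taylorCoeff, Nat.add_sub_add_right,
      Nat.cast_add, Nat.cast_one, add_assoc, one_add_one_eq_two]

end Coefficients

section Expansion

open Polynomial
open PowerSeries (mk trunc)

/-- Defect of the polynomial curve `w = p(v)` as an invariant curve of the desingularized system
with `f` replaced by the polynomial `F`. -/
noncomputable def sonicDefect (F p : ℝ[X]) (a : ℝ) : ℝ[X] :=
  (X * derivative p + p) * p + F * p - C (1 / 2) * X ^ 2 + C (a ^ 2 / 2)

variable {F p : ℝ[X]} {f v w : ℝ → ℝ} {a : ℝ} {n : ℕ}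

lemma coeff_X_mul_derivative_add (p : ℝ[X]) (k : ℕ) :
    (X * derivative p + p).coeff k = ((k : ℝ) + 1) * p.coeff k := by
  cases k with
  | zero => simp
  | succ k =>
    rw [coeff_add, coeff_X_mul, coeff_derivative]
    push_cast
    ring

lemma coeff_sonicDefect_zero (F p : ℝ[X]) (a : ℝ) :
    (sonicDefect F p a).coeff 0 = p.coeff 0 ^ 2 + F.coeff 0 * p.coeff 0 + a ^ 2 / 2 := by
  simp [sonicDefect, mul_coeff_zero, sq]

lemma coeff_mul_succ (q p : ℝ[X]) (k : ℕ) :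
    (q * p).coeff (k + 1) = q.coeff 0 * p.coeff (k + 1) +
      ∑ i ∈ Finset.range (k + 1), q.coeff (i + 1) * p.coeff (k - i) := by
  rw [coeff_mul, Finset.Nat.sum_antidiagonal_eq_sum_range_succ (fun i j => q.coeff i * p.coeff j),
    Finset.sum_range_succ', add_comm, Nat.sub_zero]
  simp only [Nat.add_sub_add_right]

lemma coeff_sonicDefect_succ (F p : ℝ[X]) (a : ℝ) (k : ℕ) :
    (sonicDefect F p a).coeff (k + 1) =
      (F.coeff 0 + ((k : ℝ) + 3) * p.coeff 0) * p.coeff (k + 1) - sonicRhs F.coeff p.coeff k := by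
  have hsum : ∑ i ∈ Finset.range k, (((i + 1 : ℕ) : ℝ) + 1) * p.coeff (i + 1) * p.coeff (k - i) =
      ∑ i ∈ Finset.range k, ((i : ℝ) + 2) * p.coeff (i + 1) * p.coeff (k - i) := by
    simp only [Nat.cast_add, Nat.cast_one, add_assoc, one_add_one_eq_two]
  have hite : (if k + 1 = 2 then (1 / 2 : ℝ) else 0) = if k = 1 then 1 / 2 else 0 := by
    simp only [Nat.succ_inj]
  rw [sonicDefect, coeff_add, coeff_sub, coeff_add, coeff_mul_succ, coeff_mul_succ,
    coeff_C_mul_X_pow, coeff_C_succ, Finset.sum_range_succ, Nat.sub_self]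
  simp only [coeff_X_mul_derivative_add, hsum, hite, sonicRhs]
  push_cast
  ring

lemma X_pow_dvd_sonicDefect
    (h₀ : p.coeff 0 ^ 2 + F.coeff 0 * p.coeff 0 + a ^ 2 / 2 = 0)
    (h : ∀ k ≤ n,
      (F.coeff 0 + ((k : ℝ) + 3) * p.coeff 0) * p.coeff (k + 1) = sonicRhs F.coeff p.coeff k) :
    X ^ (n + 2) ∣ sonicDefect F p a := by
  rw [X_pow_dvd_iff]
  rintro (_ | k) hk
  · rw [coeff_sonicDefect_zero, h₀]
  · rw [coeff_sonicDefect_succ, h k (by omega), sub_self]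

lemma eval_sonicDefect (F p : ℝ[X]) (a x : ℝ) : (sonicDefect F p a).eval x =
    x * (derivative p).eval x * p.eval x -
      transverseField (fun x => F.eval x) a x (p.eval x) := by
  simp only [sonicDefect, transverseField, eval_add, eval_sub, eval_mul, eval_pow, eval_X, eval_C]
  ring

lemma isLittleO_sub_transverseField (hdvd : X ^ (n + 2) ∣ sonicDefect F p a)
    (hfF : (fun x => f x - F.eval x) =o[𝓝 0] fun x => x ^ (n + 1)) :
    (fun x => x * (derivative p).eval x * p.eval x - transverseField f a x (p.eval x))
      =o[𝓝 0] fun x => x ^ (n + 1) := by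
  obtain ⟨Q, hQ⟩ := hdvd
  have hdefect : (fun x => (sonicDefect F p a).eval x) =o[𝓝 0] fun x => x ^ (n + 1) := by
    simp only [hQ, eval_mul, eval_pow, eval_X]
    exact ((Asymptotics.isLittleO_pow_pow (Nat.lt_succ_self (n + 1))).mul_isBigO
      ((Q.continuous.tendsto 0).isBigO_one ℝ)).congr_right fun x => mul_one _
  have hfriction : (fun x => (f x - F.eval x) * p.eval x) =o[𝓝 0] fun x => x ^ (n + 1) :=
    (hfF.mul_isBigO ((p.continuous.tendsto 0).isBigO_one ℝ)).congr_right fun x => mul_one _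
  refine (hdefect.add hfriction).congr_left fun x => ?_
  rw [eval_sonicDefect]
  simp only [transverseField]
  ring

lemma eval_trunc_mk (c : ℕ → ℝ) (N : ℕ) (x : ℝ) :
    (trunc N (mk c)).eval x = ∑ k ∈ Finset.range N, c k * x ^ k := by
  simp only [eval, PowerSeries.eval₂_trunc_eq_sum_range, PowerSeries.coeff_mk, RingHom.id_apply]

lemma coeff_trunc_mk (c : ℕ → ℝ) {k N : ℕ} (hk : k < N) : (trunc N (mk c)).coeff k = c k := by
  rw [PowerSeries.coeff_trunc, if_pos hk, PowerSeries.coeff_mk]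

lemma isLittleO_sub_eval_taylor (hf : ContDiff ℝ n f) :
    (fun x => f x - (trunc (n + 1) (mk (taylorCoeff f))).eval x) =o[𝓝 0] fun x => x ^ n := by
  refine (taylor_isLittleO_univ (x₀ := 0) hf).congr (fun x => ?_) fun x => by rw [sub_zero]
  rw [eval_trunc_mk, taylor_within_apply]
  congr 1
  refine Finset.sum_congr rfl fun k _ => ?_
  rw [iteratedDerivWithin_univ, taylorCoeff, smul_eq_mul, sub_zero]
  ring

lemma isLittleO_sonicCoeff (hf : ContDiff ℝ ((n + 1 : ℕ) : WithTop ℕ∞) f)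
    (hquad : wZero f a ^ 2 + f 0 * wZero f a + a ^ 2 / 2 = 0)
    (hne : ∀ k ≤ n, f 0 + ((k : ℝ) + 3) * wZero f a ≠ 0)
    (hp : p = trunc (n + 2) (mk (sonicCoeff (taylorCoeff f) (wZero f a)))) :
    (fun x => x * (derivative p).eval x * p.eval x - transverseField f a x (p.eval x))
      =o[𝓝 0] fun x => x ^ (n + 1) := by
  have hpc : ∀ k < n + 2, p.coeff k = sonicCoeff (taylorCoeff f) (wZero f a) k := fun k hk => by
    rw [hp, coeff_trunc_mk _ hk]
  refine isLittleO_sub_transverseField (X_pow_dvd_sonicDefect ?_ fun k hk => ?_)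
    (isLittleO_sub_eval_taylor hf)
  · rwa [coeff_trunc_mk _ (by omega), taylorCoeff_zero, hpc 0 (by omega), sonicCoeff_zero]
  · rw [coeff_trunc_mk _ (by omega), taylorCoeff_zero, hpc 0 (by omega), sonicCoeff_zero,
      hpc (k + 1) (by omega), sonicCoeff_succ, taylorCoeff_zero, mul_div_cancel₀ _ (hne k hk)]
    exact sonicRhs_congr (fun i hi => (coeff_trunc_mk _ (by omega)).symm)
      fun i hi => (hpc i (by omega)).symm

namespace IsSonicCrossing

lemma hasDerivAt_remainder (h : IsSonicCrossing f a v w) (p : ℝ[X]) (n : ℕ) {x : ℝ} (hx : x ≠ 0) :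
    HasDerivAt (fun x => (w x - p.eval (v x)) / v x ^ (n + 1))
      ((-(w x + p.eval (v x) + f (v x) + v x * (derivative p).eval (v x) + (n + 1) * w x) *
            ((w x - p.eval (v x)) / v x ^ (n + 1)) +
          -((v x * (derivative p).eval (v x) * p.eval (v x) -
            transverseField f a (v x) (p.eval (v x))) / v x ^ (n + 1))) / v x) x := by
  have hv := h.v_ne_zero x hx
  have hpv : HasDerivAt (fun x => p.eval (v x)) ((derivative p).eval (v x) * w x) x :=
    (p.hasDerivAt (v x)).comp x (h.hasDerivAt_v x)
  refine (((h.hasDerivAt_w x hx).sub hpv).div ((h.hasDerivAt_v x).pow (n + 1))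
    (pow_ne_zero _ hv)).congr_deriv ?_
  simp only [transverseField, Pi.sub_apply, Pi.pow_apply, Nat.add_sub_cancel]
  push_cast
  field_simp
  ring

lemma isLittleO_sub_eval (h : IsSonicCrossing f a v w) (hf : ContinuousAt f 0)
    (hw₀ : wZero f a < 0) (hn : 0 < f 0 + (n + 3) * wZero f a) (hp : p.eval 0 = wZero f a)
    (hdefect : (fun x => x * (derivative p).eval x * p.eval x - transverseField f a x (p.eval x))
      =o[𝓝 0] fun x => x ^ (n + 1)) :
    (fun x => w x - p.eval (v x)) =o[𝓝 0] fun x => v x ^ (n + 1) := by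
  have hv : Tendsto v (𝓝 0) (𝓝 0) := by
    simpa only [h.v_zero] using h.continuous_v.tendsto 0
  have hp' (q : ℝ[X]) : Tendsto (fun x => q.eval (v x)) (𝓝 0) (𝓝 (q.eval 0)) :=
    (q.continuous.tendsto 0).comp hv
  have hw : Tendsto w (𝓝 0) (𝓝 (wZero f a)) := by
    simpa only [h.w_zero] using h.continuous_w.tendsto 0
  have hα := ((((hw.add (hp' p)).add (hf.tendsto.comp hv)).add
    (hv.mul (hp' (derivative p)))).add (hw.const_mul ((n : ℝ) + 1))).neg
  have hβ := (hdefect.tendsto_div_nhds_zero.comp hv).neg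
  rw [neg_zero] at hβ
  have hlim := tendsto_of_singular (h.w_zero ▸ h.hasDerivAt_v 0) h.v_zero hw₀.ne
    (eventually_mem_nhdsWithin.mono fun x hx => h.hasDerivAt_remainder p n hx)
    (hα.mono_left nhdsWithin_le_nhds) (hβ.mono_left nhdsWithin_le_nhds)
    (div_pos_of_neg_of_neg (by rw [hp]; linarith) hw₀)
  rw [neg_zero, zero_div] at hlim
  have hpunctured : (fun x => w x - p.eval (v x)) =o[𝓝[≠] 0] fun x => v x ^ (n + 1) :=
    (Asymptotics.isLittleO_iff_tendsto' <| eventually_mem_nhdsWithin.mono fun x hx hvx =>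
      absurd hvx (pow_ne_zero _ (h.v_ne_zero x hx))).2 hlim
  simpa only [insert_eq, union_compl_self, nhdsWithin_univ] using
    hpunctured.insert (by rw [h.w_zero, h.v_zero, hp, sub_self])

lemma isLittleO_sub_sum_sonicCoeff (h : IsSonicCrossing f a v w)
    (hf : ContDiff ℝ ((n + 1 : ℕ) : WithTop ℕ∞) f) (hdisc : 0 ≤ f 0 ^ 2 - 2 * a ^ 2)
    (hw₀ : wZero f a < 0) (hn : 0 < f 0 + (n + 3) * wZero f a) :
    (fun x => w x -
        ∑ k ∈ Finset.range (n + 2), sonicCoeff (taylorCoeff f) (wZero f a) k * v x ^ k)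
      =o[𝓝 0] fun x => v x ^ (n + 1) := by
  simp only [← eval_trunc_mk]
  refine h.isLittleO_sub_eval hf.continuous.continuousAt hw₀ hn ?_
    (isLittleO_sonicCoeff hf (wZero_quadratic hdisc)
      (fun k hk => (add_mul_wZero_pos_of_le hw₀.le hn hk).ne') rfl)
  rw [← coeff_zero_eq_eval_zero, coeff_trunc_mk _ (by omega), sonicCoeff_zero]

end IsSonicCrossing

end Expansion

section Shock

variable {γ R σ : ℝ} {s sm sp : GasState}

lemma sound_pos (hγ : 1 < γ) (hs : s.Admissible) : 0 < s.sound γ :=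
  Real.sqrt_pos.2 (mul_pos (mul_pos (by linarith) (by linarith)) hs.2)

lemma sound_sq (hγ : 1 < γ) (hs : s.Admissible) : s.sound γ ^ 2 = γ * (γ - 1) * s.e :=
  Real.sq_sqrt (mul_pos (mul_pos (by linarith) (by linarith)) hs.2).le

lemma sound_le_C₁ (hγ : 1 < γ) (hs : s.Admissible) (h : σ < s.u - s.sound γ) :
    s.sound γ ≤ C₁ γ σ s := by
  have hc := sound_pos hγ hs
  have hflux : 0 < s.ρ * (s.u - σ) := mul_pos hs.1 (by linarith)
  have hpressure : 0 ≤ s.pressure γ :=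
    mul_nonneg (mul_nonneg (by linarith) hs.1.le) hs.2.le
  rw [C₁, massFlux, le_div_iff₀ hflux, momentumFlux]
  calc s.sound γ * (s.ρ * (s.u - σ)) ≤ (s.u - σ) * (s.ρ * (s.u - σ)) := by
        gcongr
        linarith
    _ = s.ρ * (s.u - σ) ^ 2 := by ring
    _ ≤ s.ρ * (s.u - σ) ^ 2 + s.pressure γ := le_add_of_nonneg_right hpressure

lemma le_fPoly {j c J t x : ℝ} (hγ : 1 < γ) (hR : R ≠ 0) (hj : 0 < j) (hjJ : j ≤ J) (ht : 0 < t)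
    (h₁ : t ≤ c / (γ + 1)) (h₂ : t ≤ (γ - 1) * c / (γ + 1)) (hx : |x| ≤ t / 4) :
    4 * (γ - 1) / (J * R ^ 4 * (γ + 1)) * (t / 2) ^ 3 * (t / 2) ^ 3 * (t / 2)
      ≤ fPoly γ R j c x := by
  obtain ⟨hxl, hxu⟩ := abs_le.1 hx
  have : 0 < γ - 1 := by linarith
  have hγc : γ * c / (γ + 1) = c / (γ + 1) + (γ - 1) * c / (γ + 1) := by ring
  have hleft : t / 2 ≤ c / (γ + 1) - x := by linarith
  have hright : t / 2 ≤ x + γ * c / (γ + 1) := by linarith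
  have hmiddle : t / 2 ≤ 2 * x + (γ - 1) * c / (γ + 1) := by linarith
  have : 0 < c / (γ + 1) - x := by linarith
  have : 0 < x + γ * c / (γ + 1) := by linarith
  unfold fPoly
  gcongr

lemma contDiff_shockF (γ R σ : ℝ) (s : GasState) {n : WithTop ℕ∞} :
    ContDiff ℝ n (shockF γ R σ s) := by
  unfold shockF fPoly
  fun_prop

namespace IsOneShock

lemma sound_lt (h : IsOneShock γ sm sp σ) : sm.sound γ < sm.u - σ := by
  linarith [h.lax_left]

lemma velocity_pos (h : IsOneShock γ sm sp σ) : 0 < sm.u - σ :=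
  (Real.sqrt_nonneg _).trans_lt h.sound_lt

lemma jump_eq (h : IsOneShock γ sm sp σ) (hρ : sm.ρ ≠ 0) :
    (sp.u - sm.u) * ((γ + 1) * (sm.u - σ) * (sp.u - sm.u) +
      2 * ((sm.u - σ) ^ 2 - γ * (γ - 1) * sm.e)) = 0 := by
  have hv := h.velocity_pos
  obtain ⟨hmass, hmomentum, henergy, -, -, -⟩ := h
  simp only [massFlux, momentumFlux, energyFlux, GasState.pressure] at hmass hmomentum henergy
  have hbernoulli : γ * sp.e + (sp.u - σ) ^ 2 / 2 = γ * sm.e + (sm.u - σ) ^ 2 / 2 := by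
    refine mul_left_cancel₀ (mul_ne_zero hρ hv.ne') ?_
    linear_combination henergy - (γ * sp.e + (sp.u - σ) ^ 2 / 2) * hmass
  have himpulse : ((sm.u - σ) ^ 2 + (γ - 1) * sm.e) * (sp.u - σ) =
      ((sp.u - σ) ^ 2 + (γ - 1) * sp.e) * (sm.u - σ) := by
    refine mul_left_cancel₀ hρ ?_
    linear_combination
      -(sp.u - σ) * hmomentum + ((sp.u - σ) ^ 2 + (γ - 1) * sp.e) * hmass
  linear_combination (-2 * γ) * himpulse - 2 * (γ - 1) * (sm.u - σ) * hbernoulli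

lemma strength_eq (h : IsOneShock γ sm sp σ) (hγ : 1 < γ) (hρ : sm.ρ ≠ 0)
    (hpos : 0 < strength sm sp) :
    (γ + 1) * (sm.u - σ) * strength sm sp = (sm.u - σ) ^ 2 - γ * (γ - 1) * sm.e := by
  have hne : sp.u - sm.u ≠ 0 := abs_pos.1 (by unfold strength at hpos; linarith)
  have hjump := (mul_eq_zero.1 (h.jump_eq hρ)).resolve_left hne
  have hsupersonic : γ * (γ - 1) * sm.e < (sm.u - σ) ^ 2 :=
    (Real.sqrt_lt' h.velocity_pos).1 h.sound_lt
  have hcoef : 0 < (γ + 1) * (sm.u - σ) := mul_pos (by linarith) h.velocity_pos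
  have hlt : sp.u - sm.u < 0 := neg_of_mul_neg_right (by linarith) hcoef.le
  rw [strength, abs_of_neg hlt]
  linear_combination -hjump / 2

lemma velocity_le (h : IsOneShock γ sm sp σ) (hγ : 1 < γ) (hsm : sm.Admissible)
    (hpos : 0 < strength sm sp) (hle : strength sm sp ≤ sm.sound γ / (γ + 1)) :
    sm.u - σ ≤ 2 * sm.sound γ := by
  have hc := sound_pos hγ hsm
  have hstrength := h.strength_eq hγ hsm.1.ne' hpos
  rw [← sound_sq hγ hsm] at hstrength
  rw [le_div_iff₀ (by linarith)] at hle
  have hsq : (sm.u - σ) ^ 2 - sm.sound γ ^ 2 ≤ (sm.u - σ) * sm.sound γ := by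
    rw [← hstrength]
    linarith [mul_le_mul_of_nonneg_left hle h.velocity_pos.le]
  nlinarith [h.velocity_pos]

end IsOneShock

lemma exists_uniform_lower_bound (hγ : 1 < γ) (hR : R ≠ 0) (hsm : sm.Admissible) :
    ∃ δ > 0, ∃ m > 0, ∀ (sp : GasState) (σ : ℝ), IsOneShock γ sm sp σ →
      strength sm sp ∈ Ioc 0 δ → ∀ x, |x| ≤ δ → m ≤ shockF γ R σ sm x := by
  have hc := sound_pos hγ hsm
  have : 0 < γ - 1 := by linarith
  have hρ := hsm.1
  obtain ⟨t, ht, ht₁, ht₂⟩ : ∃ t > 0, t ≤ sm.sound γ / (γ + 1) ∧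
      t ≤ (γ - 1) * sm.sound γ / (γ + 1) :=
    ⟨_, lt_min (by positivity) (by positivity), min_le_left _ _, min_le_right _ _⟩
  refine ⟨t / 4, by positivity, 4 * (γ - 1) / (sm.ρ * (2 * sm.sound γ) * R ^ 4 * (γ + 1)) *
    (t / 2) ^ 3 * (t / 2) ^ 3 * (t / 2), by positivity, fun sp σ h hmem x hx => ?_⟩
  have hv := h.velocity_le hγ hsm hmem.1 (by linarith [hmem.2])
  have hC := sound_le_C₁ hγ hsm h.lax_left
  exact le_fPoly hγ hR (mul_pos hρ h.velocity_pos) (mul_le_mul_of_nonneg_left hv hρ.le) ht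
    (ht₁.trans (by gcongr)) (ht₂.trans (by gcongr)) hx

lemma exists_antitone_strength_bound (hγ : 1 < γ) (hR : R ≠ 0) (hsm : sm.Admissible) :
    ∃ A : ℕ → ℝ, Antitone A ∧ (∀ n, 0 < A n) ∧
      ∀ (n : ℕ) (sp : GasState) (σ : ℝ), IsOneShock γ sm sp σ → strength sm sp ∈ Ioc 0 (A n) →
        ∀ x, |x| ≤ strength sm sp → (n + 3) * strength sm sp ≤ shockF γ R σ sm x := by
  obtain ⟨δ, hδ, m, hm, hbound⟩ := exists_uniform_lower_bound hγ hR hsm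
  refine ⟨fun n => min δ (m / (n + 3)), fun n n' hn => ?_, fun n => lt_min hδ (by positivity),
    fun n sp σ h hmem x hx => ?_⟩
  · dsimp only
    gcongr
  · obtain ⟨hpos, hle⟩ := hmem
    have hδ' := hle.trans (min_le_left _ _)
    have hm' := (le_div_iff₀' (by positivity)).1 (hle.trans (min_le_right _ _))
    exact hm'.trans (hbound sp σ h ⟨hpos, hδ'⟩ x (hx.trans hδ'))

end Shock

end RadShock

theorem theorem3p2_general (γ R : ℝ) (hγ : 1 < γ) (hR : R ≠ 0) (sm : GasState)
    (hsm : sm.Admissible) :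
    ∃ A : ℕ → ℝ, Antitone A ∧ (∀ n, 0 < A n) ∧
      ∀ (n : ℕ) (sp : GasState) (σ : ℝ), IsOneShock γ sm sp σ →
        ∀ (a : ℝ) (f : ℝ → ℝ), a = strength sm sp → f = shockF γ R σ sm → a ∈ Ioc 0 (A n) →
          0 < f 0 ^ 2 - 2 * a ^ 2 ∧ wZero f a < 0 ∧
          (∃ V W : ℝ → ℝ, IsFlat f a V W) ∧ (∃ V W : ℝ → ℝ, IsSharp f a V W) ∧
          ∃ wc bc : ℕ → ℝ, IsCoeffs f a n wc bc ∧
            ∀ Vf Wf Vs Ws : ℝ → ℝ, IsFlat f a Vf Wf → IsSharp f a Vs Ws →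
              BijOn (Xi Vf) univ (Iio 0) ∧ BijOn (Xi Vs) univ (Ioi 0) ∧
              ∀ v w : ℝ → ℝ, v = glue Vf Vs Vf Vs 0 → w = glue Vf Vs Wf Ws (wZero f a) →
                IsProfile f a v w ∧
                ContDiff ℝ ((n + 1 : ℕ) : WithTop ℕ∞) w ∧
                ContDiff ℝ ((n + 2 : ℕ) : WithTop ℕ∞) v ∧
                (fun ξ => w ξ - ∑ k ∈ Finset.range (n + 2), wc k * v ξ ^ k)
                  =o[𝓝 0] (fun ξ => v ξ ^ (n + 1)) := by
  obtain ⟨A, hA, hApos, hbound⟩ := exists_antitone_strength_bound hγ hR hsm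
  refine ⟨A, hA, hApos, fun n sp σ hshock a f ha hf hmem => ?_⟩
  have hna : ∀ x ∈ Icc (-a) a, (n + 3) * a ≤ f x := fun x hx => by
    subst ha hf
    exact hbound n sp σ hshock hmem x (abs_le.2 hx)
  have ha₀ := hmem.1
  have hsmooth : ContDiff ℝ ((n + 1 : ℕ) : WithTop ℕ∞) f := hf ▸ contDiff_shockF γ R σ sm
  have hfa : ∀ x ∈ Icc (-a) a, 2 * a ≤ f x := fun x hx => by
    nlinarith [hna x hx, n.cast_nonneg (α := ℝ)]
  have h0 : (0 : ℝ) ∈ Icc (-a) a := ⟨by linarith, ha₀.le⟩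
  have hdisc := discrim_pos ha₀ (hfa 0 h0)
  have hw₀ := wZero_neg ha₀ (hfa 0 h0)
  have hn := add_mul_wZero_pos ha₀ (hna 0 h0)
  refine ⟨hdisc, hw₀,
    exists_isFlat hsmooth.continuous ha₀ fun x hx => hfa x (Icc_subset_Icc_left h0.1 hx),
    exists_isSharp hsmooth.continuous ha₀ fun x hx => hfa x (Icc_subset_Icc_right h0.2 hx),
    _, _, isCoeffs_sonicCoeff fun k hk => (add_mul_wZero_pos_of_le hw₀.le hn hk).ne',
    fun Vf Wf Vs Ws hF hS => ⟨hF.bijOn_Xi, hS.bijOn_Xi, ?_⟩⟩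
  rintro v w rfl rfl
  have hcross := isSonicCrossing_glue hF hS
  have hw := hcross.contDiff_w hsmooth hw₀ hn
  exact ⟨isProfile_glue ha₀ hdisc.le hF hS (hw.differentiable (by simp)), hw,
    hcross.contDiff_v hsmooth hw₀ hn,
    hcross.isLittleO_sub_sum_sonicCoeff hsmooth hdisc.le hw₀ hn⟩

theorem theorem3p2 (γ R : ℝ) (hγ : 1 < γ)
    (hγ' : γ < (Real.sqrt 7 + 1) / (Real.sqrt 7 - 1)) (hR : 0 < R)
    (sm : GasState) (hsm : sm.Admissible) :
    ∃ A : ℕ → ℝ, Antitone A ∧ (∀ n, 0 < A n) ∧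
      ∀ (n : ℕ) (sp : GasState) (σ : ℝ), sp.Admissible → IsOneShock γ sm sp σ →
        ∀ (a : ℝ) (f : ℝ → ℝ), a = strength sm sp → f = shockF γ R σ sm → a ∈ Ioc 0 (A n) →
          -- the number `w₀` and the two orbits exist
          0 < f 0 ^ 2 - 2 * a ^ 2 ∧ wZero f a < 0 ∧
          (∃ V W : ℝ → ℝ, IsFlat f a V W) ∧ (∃ V W : ℝ → ℝ, IsSharp f a V W) ∧
          ∃ wc bc : ℕ → ℝ, IsCoeffs f a n wc bc ∧
            ∀ Vf Wf Vs Ws : ℝ → ℝ, IsFlat f a Vf Wf → IsSharp f a Vs Ws →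
              -- the changes of variable used in the gluing are bijections
              BijOn (Xi Vf) univ (Iio 0) ∧ BijOn (Xi Vs) univ (Ioi 0) ∧
              ∀ v w : ℝ → ℝ, v = glue Vf Vs Vf Vs 0 → w = glue Vf Vs Wf Ws (wZero f a) →
                IsProfile f a v w ∧
                ContDiff ℝ ((n + 1 : ℕ) : WithTop ℕ∞) w ∧
                ContDiff ℝ ((n + 2 : ℕ) : WithTop ℕ∞) v ∧
                (fun ξ => w ξ - ∑ k ∈ Finset.range (n + 2), wc k * v ξ ^ k)
                  =o[𝓝 0] (fun ξ => v ξ ^ (n + 1)) := by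
  obtain ⟨A, hA, hpos, h⟩ := theorem3p2_general γ R hγ hR.ne' sm hsm
  exact ⟨A, hA, hpos, fun n sp σ _ => h n sp σ⟩
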